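/- Let $\mu,\lambda\ge 0$ be finite (regular) Borel measures on the unit circle $\partial\mathbb D$; inner products and forms are conjugate linear in the first argument. Let $A(\mathbb D)$ be the disk algebra, and for $z\in\mathbb D$ let $k_z(\zeta)=(1-\bar z\zeta)^{-1}\in A(\mathbb D)$. Let $H^2(\mu)$ be the closure of the analytic polynomials in $L^2(\mu)$, and let $\mathscr H^+(\mu)$ be the Hilbert space of the functions $(\mathscr C_\mu h)(z)=\int_{\partial\mathbb D}\frac{h(\zeta)}{1-z\bar\zeta}\,\mu(d\zeta)=\langle k_z,h\rangle_{L^2(\mu)}$ on $\mathbb D$, $h\in H^2(\mu)$, with $\langle \mathscr C_\mu g,\mathscr C_\mu h\rangle_\mu=\langle g,h\rangle_{L^2(\mu)}$, so that $\mathscr C_\mu:H^2(\mu)\to\mathscr H^+(\mu)$ is unitary. Put $\mathrm{int}(\mu,\lambda)=\mathscr H^+(\mu)\cap\mathscr H^+(\lambda)$ (intersection of sets of functions), and let $\mathrm{int}(\mu,\lambda)^{-\mu}$ be its closure in $\mathscr H^+(\mu)$. Let $\mathfrak q_\mu(g,h)=\int_{\partial\mathbb D}\bar g h\,d\mu$,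 $g,h\in A(\mathbb D)$, regarded as a positive semi-definite form in $H^2(\lambda)$ with dense form domain $A(\mathbb D)$ through the canonical map $A(\mathbb D)\to H^2(\lambda)$ (which need not be injective). A densely defined positive semi-definite form $\mathfrak t$ in $H^2(\lambda)$ is closed if $\mathrm{Dom}\,\mathfrak t$ is complete for the norm $(\|x\|^2+\mathfrak t(x,x))^{1/2}$; it extends a form $\mathfrak q$ if the image of $\mathrm{Dom}\,\mathfrak q$ lies in $\mathrm{Dom}\,\mathfrak t$ and $\mathfrak t$ agrees with $\mathfrak q$ there; $\mathfrak q$ is closeable if it has a closed extension, and the smallest closed extension is its closure $\overline{\mathfrak q}$. Write $\mathfrak p\le\mathfrak q$ if (the image of) $\mathrm{Dom}\,\mathfrak q$ is contained in $\mathrm{Dom}\,\mathfrak p$ and $\mathfrak p(x,x)\le\mathfrak q(x,x)$ for all $x\in\mathrm{Dom}\,\mathfrak q$. Then $\mathfrak q_\mu$ has a unique Simon–Lebesgue decomposition $\mathfrak q_\mu=\mathfrak q_{ac}+\mathfrak q_s$ into positive semi-definite forms on $A(\mathbb D)$ such that $\mathfrak q_{ac}$ is closeable and is the largest closeable positive form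 $\le\mathfrak q_\mu$, and $\mathfrak q_s$ is singular, i.e. the only closeable positive form $\le\mathfrak q_s$ is $0$. Let $H^2(\mathfrak q_{ac})$ be the Hilbert space completion of $A(\mathbb D)$, modulo vectors of length zero, for the semi-inner product $\mathfrak q_{ac}$, and let $\mathscr H^+(\mathfrak q_{ac})$ be the Hilbert space of the functions $(\mathscr C_{ac}h)(z)=\langle k_z,h\rangle_{H^2(\mathfrak q_{ac})}$, $h\in H^2(\mathfrak q_{ac})$, with $\langle\mathscr C_{ac}g,\mathscr C_{ac}h\rangle_{ac}=\langle g,h\rangle_{H^2(\mathfrak q_{ac})}$. Then $$\mathscr H^+(\mathfrak q_{ac})=\mathrm{int}(\mu,\lambda)^{-\mu}=\bigl(\mathscr H^+(\mu)\cap\mathscr H^+(\lambda)\bigr)^{-\|\cdot\|_\mu}$$ as Hilbert spaces of functions on $\mathbb D$ (same functions, same inner product). Moreover, let $\mathrm e:\mathrm{int}(\mu,\lambda)\to\mathscr H^+(\lambda)$, $\mathrm e f=f$, be regarded as a densely defined operator from the Hilbert space $\mathrm{int}(\mu,\lambda)^{-\mu}\subseteq\mathscr H^+(\mu)$ into $\mathscr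 H^+(\lambda)$. Then $\mathrm e$ is closed, the operator $$D=\mathscr C_\lambda^*\,\mathrm e\,\mathrm e^*\,\mathscr C_\lambda,$$ on its natural domain in $H^2(\lambda)$, is densely defined, self-adjoint and positive semi-definite, and $\overline{\mathfrak q_{ac}}=\mathfrak q_D$, where $\mathrm{Dom}\,\mathfrak q_D=\mathrm{Dom}\sqrt D$ and $\mathfrak q_D(x,y)=\langle\sqrt D x,\sqrt D y\rangle_{H^2(\lambda)}$. -/

import Mathlib

open MeasureTheory Metric Filter Topology InnerProductSpace
open scoped ComplexOrder ComplexConjugate Complex.UnitDisc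

namespace CauchyForms

noncomputable section

/-! ### Positive semi-definite forms in a Hilbert space -/

/-- A positive semi-definite sesquilinear form on a complex vector space `V`, conjugate linear in
the first and linear in the second argument. -/
structure PSForm (V : Type*) [AddCommGroup V] [Module ℂ V] where
  toFun : V →ₗ⋆[ℂ] V →ₗ[ℂ] ℂ
  isPosSemidef : toFun.IsPosSemidef

instance {V : Type*} [AddCommGroup V] [Module ℂ V] :
    CoeFun (PSForm V) (fun _ => V → V → ℂ) :=
  ⟨fun q x y => q.toFun x y⟩

/-- A densely defined positive semi-definite form in a Hilbert space `H`. -/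
structure DenseForm (H : Type*) [NormedAddCommGroup H] [InnerProductSpace ℂ H] where
  dom : Submodule ℂ H
  dense_dom : Dense (dom : Set H)
  form : PSForm dom

section Forms

variable {H : Type*} [NormedAddCommGroup H] [InnerProductSpace ℂ H]
variable {V : Type*} [AddCommGroup V] [Module ℂ V]

/-- A form `t` is closed if its domain is complete for the norm
`‖x‖² + t(x, x)`: Cauchy sequences for this norm converge in this norm. -/
def DenseForm.IsClosed (t : DenseForm H) : Prop :=
  ∀ u : ℕ → t.dom,
    (∀ ε : ℝ, 0 < ε → ∃ N, ∀ m, N ≤ m → ∀ n, N ≤ n →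
      ‖u m - u n‖ ^ 2 + (t.form (u m - u n) (u m - u n)).re < ε) →
    ∃ x : t.dom, Tendsto (fun n => ‖u n - x‖ ^ 2 + (t.form (u n - x) (u n - x)).re) atTop (𝓝 0)

/-- A form `q` on a vector space `V` which is mapped into `H` by `ι` is regarded as a form in `H`
with form domain `V`. If `ι` is the inclusion of a subspace, this is a form whose domain is that
subspace. The form `t` in `H` extends `q` if its domain contains the image of `V`
and `t(ι v, ι w) = q(v, w)`. -/
def DenseForm.Extends (t : DenseForm H) (ι : V →ₗ[ℂ] H) (q : PSForm V) : Prop :=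
  ∃ h : ∀ v, ι v ∈ t.dom, ∀ v w, t.form ⟨ι v, h v⟩ ⟨ι w, h w⟩ = q v w

/-- `q` is closeable (absolutely continuous) in `H` if it has a closed extension. -/
def IsCloseable (ι : V →ₗ[ℂ] H) (q : PSForm V) : Prop :=
  ∃ t : DenseForm H, t.IsClosed ∧ t.Extends ι q

/-- `t` is the closure of `q`: the smallest closed extension. -/
def DenseForm.IsClosureOf (t : DenseForm H) (ι : V →ₗ[ℂ] H) (q : PSForm V) : Prop :=
  t.IsClosed ∧ t.Extends ι q ∧
    ∀ s : DenseForm H, s.IsClosed → s.Extends ι q → s.Extends t.dom.subtype t.form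

/-- The order `p ≤ q` of forms: the domain of `q` is contained in that of `p`,
and `p(x, x) ≤ q(x, x)` for `x` in the domain of `q`. -/
def DenseForm.LE (p : DenseForm H) (ι : V →ₗ[ℂ] H) (q : PSForm V) : Prop :=
  ∃ h : ∀ v, ι v ∈ p.dom, ∀ v, p.form ⟨ι v, h v⟩ ⟨ι v, h v⟩ ≤ q v v

/-- `q = qac + qs` is the Simon–Lebesgue decomposition of the form `q` in `H`, with form domain `V`:
`qac` is closeable, and it is the largest closeable form below `q`, and `qs` is singular, that is,
the only closeable form below it is zero.
(That `qac ≤ q` and `qs ≤ q` holds because both forms are positive.) -/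
structure IsSimonLebesgue (ι : V →ₗ[ℂ] H) (q qac qs : PSForm V) : Prop where
  add_eq : ∀ v w, q v w = qac v w + qs v w
  closeable : IsCloseable ι qac
  maximal : ∀ p : DenseForm H, IsCloseable p.dom.subtype p.form → p.LE ι q → p.LE ι qac
  singular : ∀ p : DenseForm H, IsCloseable p.dom.subtype p.form → p.LE ι qs →
    ∀ x y, p.form x y = 0

theorem IsSimonLebesgue.ac_le {ι : V →ₗ[ℂ] H} {q qac qs : PSForm V}
    (h : IsSimonLebesgue ι q qac qs) (v : V) : qac v v ≤ q v v := by
  rw [h.add_eq v v]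
  exact le_add_of_nonneg_right (qs.isPosSemidef.isNonneg.nonneg v)

end Forms

/-! ### Unbounded operators -/

/-- The product `B A` of unbounded operators on its natural domain
`{x ∈ Dom A | A x ∈ Dom B}`. -/
def opComp {E F G : Type*} [AddCommGroup E] [Module ℂ E] [AddCommGroup F] [Module ℂ F]
    [AddCommGroup G] [Module ℂ G] (B : F →ₗ.[ℂ] G) (A : E →ₗ.[ℂ] F) : E →ₗ.[ℂ] G where
  domain := (B.domain.comap A.toFun).map A.domain.subtype
  toFun := B.toFun ∘ₗ
    (A.toFun ∘ₗ Submodule.inclusion (Submodule.map_subtype_le _ _)).codRestrict B.domain (by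
      rintro ⟨_, x, hx, rfl⟩
      exact hx)

theorem mem_opComp_domain {E F G : Type*} [AddCommGroup E] [Module ℂ E] [AddCommGroup F]
    [Module ℂ F] [AddCommGroup G] [Module ℂ G] (B : F →ₗ.[ℂ] G) (A : E →ₗ.[ℂ] F) (x : E) :
    x ∈ (opComp B A).domain ↔ ∃ h : x ∈ A.domain, A ⟨x, h⟩ ∈ B.domain := by
  constructor
  · rintro ⟨y, hy, rfl⟩
    exact ⟨y.2, hy⟩
  · rintro ⟨h, hx⟩
    exact ⟨⟨x, h⟩, hx, rfl⟩

theorem opComp_apply {E F G : Type*} [AddCommGroup E] [Module ℂ E] [AddCommGroup F]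
    [Module ℂ F] [AddCommGroup G] [Module ℂ G] (B : F →ₗ.[ℂ] G) (A : E →ₗ.[ℂ] F)
    (x : E) (h : x ∈ A.domain) (h' : A ⟨x, h⟩ ∈ B.domain) (hx : x ∈ (opComp B A).domain) :
    opComp B A ⟨x, hx⟩ = B ⟨A ⟨x, h⟩, h'⟩ := rfl

section Operators

variable {H : Type*} [NormedAddCommGroup H] [InnerProductSpace ℂ H] [CompleteSpace H]

/-- Densely defined, self-adjoint and positive semi-definite operators. -/
structure IsPosSelfAdjoint (A : H →ₗ.[ℂ] H) : Prop where
  dense_domain : Dense (A.domain : Set H)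
  adjoint_eq : A.adjoint = A
  nonneg : ∀ x : A.domain, 0 ≤ ⟪(x : H), A x⟫_ℂ

/-- `t` is the form `q_A` of the positive self-adjoint operator `A`, that is, `Dom t = Dom √A` and
`t(x, y) = ⟪√A x, √A y⟫`. The operator `S` below is the positive square root `√A`. -/
def DenseForm.IsFormOf (t : DenseForm H) (A : H →ₗ.[ℂ] H) : Prop :=
  IsPosSelfAdjoint A ∧
    ∃ S : H →ₗ.[ℂ] H, IsPosSelfAdjoint S ∧ opComp S S = A ∧
      ∃ h : t.dom = S.domain, ∀ x y : t.dom,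
        t.form x y = ⟪S ⟨x, h ▸ x.2⟩, S ⟨y, h ▸ y.2⟩⟫_ℂ

end Operators

/-! ### The disk algebra and its Szegő kernels -/

/-- The unit circle. -/
abbrev circ : Type := sphere (0 : ℂ) 1

/-- The disk algebra `A(𝔻)`, with the supremum norm: continuous functions on the closed unit disk
which are analytic in the open disk. -/
def diskAlgebra : Submodule ℂ C(closedBall (0 : ℂ) 1, ℂ) where
  carrier := {f | ∃ F : ℂ → ℂ, DifferentiableOn ℂ F (ball 0 1) ∧
    ∀ z : closedBall (0 : ℂ) 1, (z : ℂ) ∈ ball (0 : ℂ) 1 → F z = f z}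
  add_mem' := by
    rintro f g ⟨F, hF, hFf⟩ ⟨G, hG, hGg⟩
    exact ⟨F + G, hF.add hG, fun z hz => by simp [hFf z hz, hGg z hz]⟩
  zero_mem' := ⟨0, differentiableOn_const 0, fun z hz => by simp⟩
  smul_mem' := by
    rintro c f ⟨F, hF, hFf⟩
    exact ⟨c • F, hF.const_smul c, fun z hz => by simp [hFf z hz]⟩

/-- Boundary values `A(𝔻) → C(∂𝔻)`. -/
def boundary : diskAlgebra →L[ℂ] C(circ, ℂ) :=
  LinearMap.mkContinuous
    { toFun := fun f => (f : C(closedBall (0 : ℂ) 1, ℂ)).comp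
        ⟨fun ζ => ⟨(ζ : ℂ), sphere_subset_closedBall ζ.2⟩, by fun_prop⟩
      map_add' := fun f g => rfl
      map_smul' := fun c f => rfl } 1 (by
    intro f
    rw [one_mul]
    refine (ContinuousMap.norm_le _ (norm_nonneg _)).2 fun ζ => ?_
    exact (f : C(closedBall (0 : ℂ) 1, ℂ)).norm_coe_le_norm _)

theorem boundary_apply (f : diskAlgebra) (ζ : circ) :
    boundary f ζ =
      (f : C(closedBall (0 : ℂ) 1, ℂ)) ⟨(ζ : ℂ), sphere_subset_closedBall ζ.2⟩ := rfl

/-- The monomial `ζ ^ n` as an element of the disk algebra. -/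
def mono (n : ℕ) : diskAlgebra :=
  ⟨⟨fun w => (w : ℂ) ^ n, by fun_prop⟩, fun w => w ^ n, by fun_prop, fun _ _ => rfl⟩

theorem one_sub_ne_zero {z w : ℂ} (hz : ‖z‖ < 1) (hw : ‖w‖ ≤ 1) : 1 - conj z * w ≠ 0 := by
  intro h
  have h1 : conj z * w = 1 := (sub_eq_zero.1 h).symm
  have h2 : ‖conj z * w‖ < 1 := by
    rw [norm_mul, RCLike.norm_conj]
    calc ‖z‖ * ‖w‖ ≤ ‖z‖ * 1 := by gcongr
      _ < 1 := by simpa using hz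
  rw [h1] at h2
  simp at h2

/-- The Szegő kernel vector `k_z(ζ) = (1 - z̄ ζ)⁻¹`, an element of the disk algebra. -/
def szego (z : 𝔻) : diskAlgebra :=
  ⟨⟨fun w => (1 - conj (z : ℂ) * (w : ℂ))⁻¹, by
      refine Continuous.inv₀ (by fun_prop) fun w => ?_
      exact one_sub_ne_zero z.norm_lt_one (mem_closedBall_zero_iff.1 w.2)⟩,
    fun w => (1 - conj (z : ℂ) * w)⁻¹, by
      refine DifferentiableOn.inv (by fun_prop) fun w hw => ?_
      exact one_sub_ne_zero z.norm_lt_one (mem_ball_zero_iff.1 hw).le,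
    fun _ _ => rfl⟩

theorem norm_mono_le (n : ℕ) : ‖mono n‖ ≤ 1 := by
  refine (ContinuousMap.norm_le _ zero_le_one).2 fun w => ?_
  have : ‖(w : ℂ)‖ ≤ 1 := mem_closedBall_zero_iff.1 w.2
  change ‖(w : ℂ) ^ n‖ ≤ 1
  rw [norm_pow]
  exact pow_le_one₀ (norm_nonneg _) this

theorem hasSum_szego (z : 𝔻) : HasSum (fun n => (conj (z : ℂ)) ^ n • mono n) (szego z) := by
  have hind : IsInducing (diskAlgebra.subtype : diskAlgebra → C(closedBall (0 : ℂ) 1, ℂ)) :=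
    IsInducing.subtypeVal
  rw [← hind.hasSum_iff (g := diskAlgebra.subtype)]
  have hs : Summable (fun n => diskAlgebra.subtype ((conj (z : ℂ)) ^ n • mono n)) := by
    refine Summable.of_norm_bounded (g := fun n => ‖(z : ℂ)‖ ^ n)
      (summable_geometric_of_lt_one (norm_nonneg _) z.norm_lt_one) fun n => ?_
    change ‖(conj (z : ℂ)) ^ n • mono n‖ ≤ _
    rw [norm_smul, norm_pow, RCLike.norm_conj]
    exact mul_le_of_le_one_right (by positivity) (norm_mono_le n)
  have h := hs.hasSum
  convert! h using 1
  ext w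
  have hw : ‖(w : ℂ)‖ ≤ 1 := mem_closedBall_zero_iff.1 w.2
  have h1 := ContinuousMap.hasSum_apply h w
  have hlt : ‖conj (z : ℂ) * (w : ℂ)‖ < 1 := by
    rw [norm_mul, RCLike.norm_conj]
    calc ‖(z : ℂ)‖ * ‖(w : ℂ)‖ ≤ ‖(z : ℂ)‖ * 1 := by gcongr
      _ < 1 := by simpa using z.norm_lt_one
  have h2 := hasSum_geometric_of_norm_lt_one hlt
  refine HasSum.unique ?_ h1
  convert! h2 using 1
  funext n
  change (conj (z : ℂ)) ^ n * (w : ℂ) ^ n = _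
  rw [mul_pow]

/-- Polynomials are dense in the disk algebra. -/
theorem span_mono_dense : (Submodule.span ℂ (Set.range mono)).topologicalClosure = ⊤ := by
  rw [Submodule.eq_top_iff']
  rintro ⟨f, F, hF, hFf⟩
  refine Metric.mem_closure_iff.2 fun ε hε => ?_
  have hfu : UniformContinuous f := CompactSpace.uniformContinuous_of_continuous f.continuous
  obtain ⟨δ, hδ, hfδ⟩ := Metric.uniformContinuous_iff.1 hfu (ε / 4) (by positivity)
  obtain ⟨r, hr0, hr1, hrδ⟩ : ∃ r : ℝ, 0 < r ∧ r < 1 ∧ 1 - r < δ :=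
    ⟨max (1 / 2) (1 - δ / 2), by positivity, by
      refine max_lt (by norm_num) (by linarith), by
      have := le_max_right (1 / 2 : ℝ) (1 - δ / 2)
      linarith⟩
  let R : NNReal := ⟨(r + 2) / 3, by positivity⟩
  let R' : NNReal := ⟨(2 * r + 1) / 3, by positivity⟩
  have hR : (R : ℝ) = (r + 2) / 3 := rfl
  have hR' : (R' : ℝ) = (2 * r + 1) / 3 := rfl
  have hd : DifferentiableOn ℂ F (closedBall 0 R) :=
    hF.mono (closedBall_subset_ball (by rw [hR]; linarith))
  have hps := hd.hasFPowerSeriesOnBall (NNReal.coe_pos.1 (by rw [hR]; linarith))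
  have hu := hps.tendstoUniformlyOn (r' := R')
    (ENNReal.coe_lt_coe.2 (NNReal.coe_lt_coe.1 (by rw [hR, hR']; linarith)))
  obtain ⟨n, hn⟩ := (Metric.tendstoUniformlyOn_iff.1 hu (ε / 4) (by positivity)).exists
  set p := cauchyPowerSeries F 0 R with hp
  refine ⟨∑ k ∈ Finset.range n, ((r : ℂ) ^ k * p.coeff k) • mono k,
    Submodule.sum_mem _ fun k _ => Submodule.smul_mem _ _ (Submodule.subset_span ⟨k, rfl⟩), ?_⟩
  refine lt_of_le_of_lt (b := ε / 2) ?_ (by linarith)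
  change dist f ((∑ k ∈ Finset.range n, ((r : ℂ) ^ k * p.coeff k) • mono k : diskAlgebra) :
    C(closedBall (0 : ℂ) 1, ℂ)) ≤ ε / 2
  refine (ContinuousMap.dist_le (by positivity)).2 fun w => ?_
  have hw : ‖(w : ℂ)‖ ≤ 1 := mem_closedBall_zero_iff.1 w.2
  have hrw : ‖(r : ℂ) * w‖ ≤ r := by
    rw [norm_mul, Complex.norm_real, Real.norm_of_nonneg hr0.le]
    exact mul_le_of_le_one_right hr0.le hw
  let w' : closedBall (0 : ℂ) 1 := ⟨(r : ℂ) * w, mem_closedBall_zero_iff.2 (hrw.trans hr1.le)⟩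
  have h1 : dist (f w) (f w') < ε / 4 := by
    refine hfδ ?_
    rw [Subtype.dist_eq, dist_eq_norm]
    have : (w : ℂ) - (w' : ℂ) = ((1 - r : ℝ) : ℂ) * w := by
      change (w : ℂ) - (r : ℂ) * w = _
      push_cast; ring
    rw [this, norm_mul, Complex.norm_real, Real.norm_of_nonneg (by linarith)]
    exact lt_of_le_of_lt (mul_le_of_le_one_right (by linarith) hw) hrδ
  have h2 := hn ((r : ℂ) * w) (mem_ball_zero_iff.2 (hrw.trans_lt (by
    change r < (2 * r + 1) / 3
    linarith)))
  rw [zero_add, hFf w' (mem_ball_zero_iff.2 (hrw.trans_lt hr1))] at h2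
  have h3 : ((∑ k ∈ Finset.range n, ((r : ℂ) ^ k * p.coeff k) • mono k : diskAlgebra) :
      C(closedBall (0 : ℂ) 1, ℂ)) w = p.partialSum n ((r : ℂ) * w) := by
    rw [AddSubmonoidClass.coe_finsetSum, ContinuousMap.sum_apply]
    refine Finset.sum_congr rfl fun k _ => ?_
    rw [FormalMultilinearSeries.apply_eq_pow_smul_coeff]
    change ((r : ℂ) ^ k * p.coeff k) * (w : ℂ) ^ k = _
    rw [smul_eq_mul, mul_pow]; ring
  rw [h3]
  refine (dist_triangle _ (f w') _).trans ?_
  linarith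

/-- A vector orthogonal to all Szegő kernel vectors vanishes. -/
theorem eq_zero_of_inner_szego {H : Type*} [NormedAddCommGroup H] [InnerProductSpace ℂ H]
    (J : diskAlgebra →L[ℂ] H) (hJ : DenseRange J) (h : H)
    (hz : ∀ z : 𝔻, ⟪J (szego z), h⟫_ℂ = 0) : h = 0 := by
  let φ : diskAlgebra →L[ℂ] ℂ := (innerSL ℂ h).comp J
  have hφ : ∀ a, φ a = ⟪h, J a⟫_ℂ := fun a => rfl
  have hsum : ∀ w : ℂ, ‖w‖ < 1 → HasSum (fun n => w ^ n • φ (mono n)) 0 := by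
    intro w hw
    have h1 := φ.hasSum (hasSum_szego (Complex.UnitDisc.mk (conj w) (by simpa using hw)))
    have h0 : φ (szego (Complex.UnitDisc.mk (conj w) (by simpa using hw))) = 0 := by
      rw [hφ, ← inner_conj_symm, hz, map_zero]
    rw [h0] at h1
    simpa using h1
  let p : FormalMultilinearSeries ℂ ℂ ℂ := .ofScalars ℂ (fun n => φ (mono n))
  have hp : HasFPowerSeriesAt (0 : ℂ → ℂ) p 0 := by
    rw [hasFPowerSeriesAt_iff]
    filter_upwards [ball_mem_nhds (0 : ℂ) one_pos] with w hw
    simpa [p, FormalMultilinearSeries.coeff_ofScalars] using hsum w (mem_ball_zero_iff.1 hw)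
  have hmono : ∀ n, φ (mono n) = 0 := by
    intro n
    have h2 : p.coeff n = 0 := by
      rw [hp.eq_zero]; rfl
    simpa [p, FormalMultilinearSeries.coeff_ofScalars] using h2
  have hker : ∀ a, φ a = 0 := by
    intro a
    have ha : a ∈ (Submodule.span ℂ (Set.range mono)).topologicalClosure := by
      rw [span_mono_dense]; trivial
    have hle : (Submodule.span ℂ (Set.range mono)).topologicalClosure ≤
        LinearMap.ker φ.toLinearMap :=
      Submodule.topologicalClosure_minimal _
        (Submodule.span_le.2 (by rintro _ ⟨n, rfl⟩; exact hmono n)) φ.isClosed_ker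
    exact hle ha
  exact hJ.eq_zero_of_inner_left ℂ (fun a => hker a)

/-! ### Hardy spaces and spaces of Cauchy transforms of measures -/

section Measures

variable (μ lam : Measure circ) [IsFiniteMeasure μ] [IsFiniteMeasure lam]

/-- The map `A(𝔻) → L²(μ)`. -/
def toL2 : diskAlgebra →L[ℂ] Lp ℂ 2 μ := (ContinuousMap.toLp 2 μ ℂ).comp boundary

/-- `H²(μ)`, the closure of the analytic polynomials in `L²(μ)`. -/
def hardy : Submodule ℂ (Lp ℂ 2 μ) :=
  (Submodule.span ℂ (Set.range fun n => toL2 μ (mono n))).topologicalClosure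

instance : CompleteSpace (hardy μ) :=
  (Submodule.isClosed_topologicalClosure _).completeSpace_coe

theorem toL2_mem_hardy (a : diskAlgebra) : toL2 μ a ∈ hardy μ := by
  have ha : a ∈ (Submodule.span ℂ (Set.range mono)).topologicalClosure := by
    rw [span_mono_dense]; trivial
  have h1 := Submodule.topologicalClosure_map (toL2 μ) (Submodule.span ℂ (Set.range mono))
    (Submodule.mem_map_of_mem ha)
  rw [Submodule.map_span, ← Set.range_comp] at h1
  exact h1

/-- The canonical map of the disk algebra into `H²(μ)`. -/
def toHardy : diskAlgebra →L[ℂ] hardy μ := (toL2 μ).codRestrict (hardy μ) (toL2_mem_hardy μ)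

theorem denseRange_toHardy : DenseRange (toHardy μ) := by
  intro x
  have hx : (x : Lp ℂ 2 μ) ∈ closure (Set.range (toL2 μ)) := by
    refine closure_mono ?_ x.2
    have : Submodule.span ℂ (Set.range fun n => toL2 μ (mono n)) ≤
        LinearMap.range (toL2 μ).toLinearMap :=
      Submodule.span_le.2 (by rintro _ ⟨n, rfl⟩; exact ⟨mono n, rfl⟩)
    exact this
  rw [IsInducing.subtypeVal.closure_eq_preimage_closure_image]
  rw [← Set.range_comp]
  exact hx

/-- The space `ℋ⁺(μ)` of `μ`-Cauchy transforms: the Hilbert space `H²(μ)`, its elements `h` being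
regarded as the functions `𝒞_μ h` in the disk. -/
def HPlus : Type := hardy μ

instance : NormedAddCommGroup (HPlus μ) := inferInstanceAs (NormedAddCommGroup (hardy μ))
instance : InnerProductSpace ℂ (HPlus μ) := inferInstanceAs (InnerProductSpace ℂ (hardy μ))
instance : CompleteSpace (HPlus μ) := inferInstanceAs (CompleteSpace (hardy μ))

/-- The Cauchy transform `𝒞_μ` as a unitary map of `H²(μ)` onto `ℋ⁺(μ)`. -/
def cauchy : hardy μ ≃ₗᵢ[ℂ] HPlus μ := LinearIsometryEquiv.refl ℂ (hardy μ)

/-- The reproducing kernel Hilbert space structure of `ℋ⁺(μ)`: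
the function in the disk is `z ↦ ⟪k_z, h⟫`. -/
instance : RKHS ℂ (HPlus μ) 𝔻 ℂ where
  coeCLM := ContinuousLinearMap.pi fun z =>
    (innerSL ℂ (toHardy μ (szego z))).comp
      ((cauchy μ).symm.toContinuousLinearEquiv : HPlus μ →L[ℂ] hardy μ)
  coeCLM_injective := by
    rw [injective_iff_map_eq_zero]
    intro f hf
    exact eq_zero_of_inner_szego (toHardy μ) (denseRange_toHardy μ) ((cauchy μ).symm f)
      fun z => congrFun hf z

/-- The functions in `ℋ⁺(μ)` are the Cauchy integrals of the elements of `H²(μ)`. -/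
theorem cauchy_apply (h : hardy μ) (z : 𝔻) :
    cauchy μ h z = ∫ ζ : circ, (h : Lp ℂ 2 μ) ζ / (1 - (z : ℂ) * conj (ζ : ℂ)) ∂μ := by
  change ⟪(toL2 μ (szego z) : Lp ℂ 2 μ), (h : Lp ℂ 2 μ)⟫_ℂ = _
  rw [L2.inner_def]
  refine integral_congr_ae ?_
  filter_upwards [ContinuousMap.coeFn_toLp (p := 2) (𝕜 := ℂ) μ (boundary (szego z))] with ζ hζ
  have h1 : (toL2 μ (szego z) : Lp ℂ 2 μ) ζ = (1 - conj (z : ℂ) * (ζ : ℂ))⁻¹ := hζ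
  rw [h1, RCLike.inner_apply]
  simp [div_eq_mul_inv]

/-- `int(μ, λ) = ℋ⁺(μ) ∩ ℋ⁺(λ)`, as a subspace of `ℋ⁺(μ)`. -/
def inter : Submodule ℂ (HPlus μ) where
  carrier := {f | ∃ g : HPlus lam, (g : 𝔻 → ℂ) = f}
  add_mem' := by
    rintro f f' ⟨g, hg⟩ ⟨g', hg'⟩
    exact ⟨g + g', by rw [RKHS.coe_add, RKHS.coe_add, hg, hg']⟩
  zero_mem' := ⟨0, by rw [RKHS.coe_zero, RKHS.coe_zero]⟩
  smul_mem' := by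
    rintro c f ⟨g, hg⟩
    exact ⟨c • g, by rw [RKHS.coe_smul, RKHS.coe_smul, hg]⟩

/-- The closure of `int(μ, λ)` in the norm of `ℋ⁺(μ)`. -/
abbrev interClosure : Submodule ℂ (HPlus μ) := (inter μ lam).topologicalClosure

instance : CompleteSpace (interClosure μ lam) :=
  (Submodule.isClosed_topologicalClosure _).completeSpace_coe

/-- The embedding `e : int(μ, λ) → ℋ⁺(λ)`, which sends a function to itself, as an operator with
domain `int(μ, λ)`, densely defined in the Hilbert space closure of `int(μ, λ)` in `ℋ⁺(μ)`. -/
def embedding : interClosure μ lam →ₗ.[ℂ] HPlus lam where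
  domain := (inter μ lam).comap (interClosure μ lam).subtype
  toFun :=
    { toFun := fun f => Classical.choose f.2
      map_add' := fun f g => DFunLike.coe_injective <| by
        refine (Classical.choose_spec (f + g).2).trans ?_
        refine (RKHS.coe_add _ _).trans ?_
        refine Eq.trans ?_ (RKHS.coe_add _ _).symm
        exact congrArg₂ _ (Classical.choose_spec f.2).symm (Classical.choose_spec g.2).symm
      map_smul' := fun c f => DFunLike.coe_injective <| by
        refine (Classical.choose_spec (c • f).2).trans ?_
        refine (RKHS.coe_smul _ _).trans ?_
        refine Eq.trans ?_ (RKHS.coe_smul _ _).symm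
        exact congrArg _ (Classical.choose_spec f.2).symm }

theorem embedding_apply (f : (embedding μ lam).domain) (z : 𝔻) :
    embedding μ lam f z = ((f : interClosure μ lam) : HPlus μ) z :=
  congrFun (Classical.choose_spec f.2) z

theorem dense_embedding_domain : Dense ((embedding μ lam).domain : Set (interClosure μ lam)) := by
  intro x
  rw [IsInducing.subtypeVal.closure_eq_preimage_closure_image]
  refine closure_mono ?_ x.2
  intro f hf
  exact ⟨⟨f, subset_closure hf⟩, hf, rfl⟩

/-- The operator `𝒞_λ* e e* 𝒞_λ` in `H²(λ)`, on its natural domain. -/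
def opD : hardy lam →ₗ.[ℂ] hardy lam :=
  opComp
    (((ContinuousLinearMap.adjoint
      ((cauchy lam).toContinuousLinearEquiv : hardy lam →L[ℂ] HPlus lam)) :
        HPlus lam →ₗ[ℂ] hardy lam).toPMap ⊤)
    (opComp (embedding μ lam)
      (opComp (embedding μ lam).adjoint
        ((((cauchy lam).toContinuousLinearEquiv : hardy lam →L[ℂ] HPlus lam) :
          hardy lam →ₗ[ℂ] HPlus lam).toPMap ⊤)))

theorem integrable_conj_mul (g h : diskAlgebra) :
    Integrable (fun ζ => conj (boundary g ζ) * boundary h ζ) μ :=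
  Continuous.integrable_of_hasCompactSupport (by fun_prop) (HasCompactSupport.of_compactSpace _)

/-- The form `q_μ(g, h) = ∫ ḡ h dμ` on the disk algebra. -/
def measureForm : PSForm diskAlgebra where
  toFun := LinearMap.mk₂'ₛₗ (starRingEnd ℂ) (RingHom.id ℂ)
    (fun g h => ∫ ζ, conj (boundary g ζ) * boundary h ζ ∂μ)
    (fun g g' h => by
      rw [← integral_add (integrable_conj_mul μ g h) (integrable_conj_mul μ g' h)]
      simp [add_mul])
    (fun c g h => by
      rw [smul_eq_mul, ← integral_const_mul]
      simp [mul_assoc])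
    (fun g h h' => by
      rw [← integral_add (integrable_conj_mul μ g h) (integrable_conj_mul μ g h')]
      simp [mul_add])
    (fun c g h => by
      rw [RingHom.id_apply, smul_eq_mul, ← integral_const_mul]
      simp [mul_left_comm])
  isPosSemidef := LinearMap.isPosSemidef_def.2
    ⟨⟨fun g h => by
      simp only [LinearMap.mk₂'ₛₗ_apply]
      rw [← integral_conj]
      simp [mul_comm]⟩,
    ⟨fun g => by
      simp only [LinearMap.mk₂'ₛₗ_apply]
      simp_rw [Complex.conj_mul']
      norm_cast
      exact integral_nonneg fun _ => by positivity⟩⟩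

theorem measureForm_apply (g h : diskAlgebra) :
    measureForm μ g h = ∫ ζ, conj (boundary g ζ) * boundary h ζ ∂μ := rfl

theorem measureForm_le (a : diskAlgebra) : (measureForm μ a a).re ≤ μ.real Set.univ * ‖a‖ ^ 2 := by
  rw [measureForm_apply]
  refine (Complex.re_le_norm _).trans ?_
  rw [mul_comm]
  refine norm_integral_le_of_norm_le_const (Eventually.of_forall fun ζ => ?_)
  rw [norm_mul, RCLike.norm_conj, sq]
  have h : ‖boundary a ζ‖ ≤ ‖a‖ := (a : C(closedBall (0 : ℂ) 1, ℂ)).norm_coe_le_norm _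
  gcongr

end Measures

/-! ### Cauchy transforms of forms on the disk algebra -/

section FormSpaces

/-- The disk algebra with the semi-inner product `q`. -/
def PreH2 (_q : PSForm diskAlgebra) : Type := diskAlgebra

variable (q : PSForm diskAlgebra)

instance : AddCommGroup (PreH2 q) := inferInstanceAs (AddCommGroup diskAlgebra)
instance : Module ℂ (PreH2 q) := inferInstanceAs (Module ℂ diskAlgebra)

instance : PreInnerProductSpace.Core ℂ (PreH2 q) where
  inner f g := q.toFun f g
  conj_inner_symm f g := q.isPosSemidef.isSymm.eq g f
  re_inner_nonneg f := (Complex.nonneg_iff.1 (q.isPosSemidef.isNonneg.nonneg f)).1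
  add_left f g h := LinearMap.map_add₂ q.toFun f g h
  smul_left f g c := LinearMap.map_smulₛₗ₂ q.toFun c f g

instance : SeminormedAddCommGroup (PreH2 q) :=
  InnerProductSpace.Core.toSeminormedAddCommGroup (𝕜 := ℂ)

instance : InnerProductSpace ℂ (PreH2 q) := .ofCore _

/-- `H²(q)`: the Hilbert space completion of the disk algebra, modulo vectors of length zero,
for the semi-inner product `q`. -/
abbrev H2 : Type := UniformSpace.Completion (PreH2 q)

/-- The canonical map of the disk algebra into `H²(q)`. -/
def toH2 : diskAlgebra →ₗ[ℂ] H2 q :=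
  (UniformSpace.Completion.toComplL : PreH2 q →L[ℂ] H2 q).toLinearMap

theorem inner_toH2 (f g : diskAlgebra) : ⟪toH2 q f, toH2 q g⟫_ℂ = q f g :=
  UniformSpace.Completion.inner_coe (𝕜 := ℂ) (E := PreH2 q) f g

variable (μ : Measure circ) [IsFiniteMeasure μ]

/-- The space `ℋ⁺(q)` of `q`-Cauchy transforms, for a positive form `q ≤ q_μ` on the disk algebra:
the Hilbert space `H²(q)`, its elements `h` being regarded as the functions
`z ↦ q(k_z, h)` in the disk. -/
def FormHPlus (_hq : ∀ a, q a a ≤ measureForm μ a a) : Type := H2 q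

variable (hq : ∀ a, q a a ≤ measureForm μ a a)

instance : NormedAddCommGroup (FormHPlus q μ hq) := inferInstanceAs (NormedAddCommGroup (H2 q))
instance : InnerProductSpace ℂ (FormHPlus q μ hq) := inferInstanceAs (InnerProductSpace ℂ (H2 q))
instance : CompleteSpace (FormHPlus q μ hq) := inferInstanceAs (CompleteSpace (H2 q))

/-- The Cauchy transform as a unitary map of `H²(q)` onto `ℋ⁺(q)`. -/
def formCauchy : H2 q ≃ₗᵢ[ℂ] FormHPlus q μ hq := LinearIsometryEquiv.refl ℂ (H2 q)

theorem formCauchy_injective (h : H2 q) (hz : ∀ z : 𝔻, ⟪toH2 q (szego z), h⟫_ℂ = 0)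
    (hq : ∀ a, q a a ≤ measureForm μ a a) : h = 0 := by
  let J : diskAlgebra →L[ℂ] H2 q :=
    (toH2 q).mkContinuous (√(μ.real Set.univ)) fun a => by
      refine abs_le_of_sq_le_sq' ?_ (by positivity) |>.2
      rw [mul_pow, Real.sq_sqrt (by positivity), ← inner_self_eq_norm_sq (𝕜 := ℂ), inner_toH2]
      exact (Complex.le_def.1 (hq a)).1.trans (measureForm_le μ a)
  exact eq_zero_of_inner_szego J
    (UniformSpace.Completion.denseRange_coe (α := PreH2 q)) h hz

instance : RKHS ℂ (FormHPlus q μ hq) 𝔻 ℂ where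
  coeCLM := ContinuousLinearMap.pi fun z =>
    (innerSL ℂ (toH2 q (szego z))).comp
      ((formCauchy q μ hq).symm.toContinuousLinearEquiv : FormHPlus q μ hq →L[ℂ] H2 q)
  coeCLM_injective := by
    rw [injective_iff_map_eq_zero]
    intro f hf
    exact formCauchy_injective q μ ((formCauchy q μ hq).symm f) (fun z => congrFun hf z) hq

theorem formCauchy_apply (h : H2 q) (z : 𝔻) :
    formCauchy q μ hq h z = ⟪toH2 q (szego z), h⟫_ℂ := rfl

end FormSpaces

end

end CauchyForms

open CauchyForms

/-! Let `a` run through the disk algebra and consider the pairs of its images in `H²(λ)` and in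
`ℋ⁺(μ)`. Up to the sign of the first component, a pair orthogonal to all of these consists of `g ∈
H²(λ)` and `f ∈ ℋ⁺(μ)` with `⟪a, f⟫_μ = ⟪a, g⟫_λ` for all `a`. Testing on Szegő kernels is enough,
so this says that `f` and `𝒞_λ g` are the same function. The orthogonal complement of the pairs is
thus, up to that sign, the graph of `e` (`coe_eq_iff_inner`, `mem_embedding_graph_iff`). In
particular `e` is closed.

Put `T = e* 𝒞_λ` and let `P` be the projection of `ℋ⁺(μ)` onto the closure of `int(μ, λ)`. Taking
adjoints gives two facts: `T a = P a` on the disk algebra (`toHardy_mem_embeddingAdjoint_graph`),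
and the graph of `T` lies in the closure of the pairs (`embeddingAdjoint_graph_subset`). A closed
form dominated by `q_μ` on the disk algebra passes to limits of such pairs, so it is dominated by
`‖P a‖²`. Modulo the range of `P` nothing closeable survives. Hence `q_ac(a, a) = ‖P a‖²` and
`q_s(a, a) = ‖(1 - P) a‖²` (`isSimonLebesgue_ofMap`), and the closure of `q_ac` is `⟪T x, T y⟫`.

The map sending the class of `a` in `H²(q_ac)` to `P a` extends to a unitary. It preserves the
functions in the disk, since `⟪P k_z, f⟫ = ⟪k_z, f⟫` for `f` in the range of `P`. Finally `e** = e`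
gives `T* T = 𝒞_λ* e e* 𝒞_λ = D`. Von Neumann's theorem on `T* T`, with the square root built from
the bounded operator `(1 + T* T)⁻¹`, identifies `⟪T x, T y⟫` with `q_D` (`DenseForm.ofOp_isFormOf`).
-/

namespace CauchyForms

/-! ### Positive forms, closed forms and closures -/

section FormLemmas

variable {H : Type*} [NormedAddCommGroup H] [InnerProductSpace ℂ H]
variable {V : Type*} [AddCommGroup V] [Module ℂ V]

theorem PSForm.toFun_injective {p q : PSForm V} (h : p.toFun = q.toFun) : p = q := by
  cases p; cases q; cases h; rfl

theorem PSForm.nonneg (q : PSForm V) (x : V) : 0 ≤ q x x := q.isPosSemidef.isNonneg.nonneg x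

/-- Polarization: a form is determined by its diagonal. -/
theorem PSForm.ext_of_diag {p q : PSForm V} (h : ∀ x, p x x = q x x) : p = q := by
  refine PSForm.toFun_injective (LinearMap.ext₂ fun x y => ?_)
  have hx := h x
  have hy := h y
  -- Two evaluations suffice: `x + y` yields `p(x, y) + p(y, x)`, and `x + i y` yields `i (p(x, y) -
  -- p(y, x))`.
  have h1 := h (x + y)
  have h2 := h (x + Complex.I • y)
  simp only [map_add, LinearMap.add_apply, map_smul, LinearMap.map_smulₛₗ, LinearMap.smul_apply,
    smul_eq_mul, Complex.conj_I] at h1 h2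
  linear_combination (1 / 2 : ℂ) * h1 - (1 / 2 : ℂ) * Complex.I * h2
    - (1 / 2 : ℂ) * (1 - Complex.I) * hx
    - (1 / 2 : ℂ) * (1 + Complex.I ^ 2 * Complex.I) * hy
    + (1 / 2 : ℂ) * (p x y - q x y - p y x + q y x) * Complex.I_sq

theorem PSForm.diag_eq_of_re {p q : PSForm V} {x : V} (h : (p x x).re = (q x x).re) :
    p x x = q x x := by
  refine Complex.ext h ?_
  rw [← (Complex.nonneg_iff.1 (p.nonneg x)).2, ← (Complex.nonneg_iff.1 (q.nonneg x)).2]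

/-- The form `⟪j x, j y⟫` of a linear map `j`. -/
def PSForm.ofMap {E : Type*} [SeminormedAddCommGroup E] [InnerProductSpace ℂ E]
    (j : V →ₗ[ℂ] E) : PSForm V where
  toFun := LinearMap.mk₂'ₛₗ (starRingEnd ℂ) (RingHom.id ℂ) (fun x y => ⟪j x, j y⟫_ℂ)
    (fun x x' y => by rw [map_add, inner_add_left])
    (fun c x y => by rw [map_smul, inner_smul_left, smul_eq_mul])
    (fun x y y' => by rw [map_add, inner_add_right])
    (fun c x y => by rw [map_smul, inner_smul_right, smul_eq_mul, RingHom.id_apply])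
  isPosSemidef := LinearMap.isPosSemidef_def.2
    ⟨⟨fun x y => inner_conj_symm _ _⟩, ⟨fun x => by
      exact Complex.nonneg_iff.2 ⟨inner_self_nonneg (𝕜 := ℂ), (inner_self_im (𝕜 := ℂ) _).symm⟩⟩⟩

theorem PSForm.ofMap_apply {E : Type*} [SeminormedAddCommGroup E] [InnerProductSpace ℂ E]
    (j : V →ₗ[ℂ] E) (x y : V) : PSForm.ofMap j x y = ⟪j x, j y⟫_ℂ := rfl

theorem PSForm.ofMap_self {E : Type*} [SeminormedAddCommGroup E] [InnerProductSpace ℂ E]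
    (j : V →ₗ[ℂ] E) (x : V) : PSForm.ofMap j x x = ((‖j x‖ ^ 2 : ℝ) : ℂ) := by
  rw [PSForm.ofMap_apply, inner_self_eq_norm_sq_to_K]
  norm_cast

theorem PSForm.re_ofMap_self {E : Type*} [SeminormedAddCommGroup E] [InnerProductSpace ℂ E]
    (j : V →ₗ[ℂ] E) (x : V) : (PSForm.ofMap j x x).re = ‖j x‖ ^ 2 := by
  rw [PSForm.ofMap_self, Complex.ofReal_re]

/-- Restriction of a form along a linear map. -/
def PSForm.comap {W : Type*} [AddCommGroup W] [Module ℂ W] (q : PSForm V) (f : W →ₗ[ℂ] V) :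
    PSForm W where
  toFun := (q.toFun.comp f).compl₂ f
  isPosSemidef := LinearMap.isPosSemidef_def.2
    ⟨⟨fun x y => q.isPosSemidef.isSymm.eq (f x) (f y)⟩, ⟨fun x => q.nonneg (f x)⟩⟩

/-- Every positive form is the form of a map into a semi-inner product space. -/
theorem PSForm.exists_eq_ofMap.{u} {V : Type u} [AddCommGroup V] [Module ℂ V] (q : PSForm V) :
    ∃ (E : Type u) (_ : SeminormedAddCommGroup E) (_ : InnerProductSpace ℂ E) (j : V →ₗ[ℂ] E),
      q = PSForm.ofMap j := by
  let c : PreInnerProductSpace.Core ℂ V :=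
    { inner := fun f g => q.toFun f g
      conj_inner_symm := fun f g => q.isPosSemidef.isSymm.eq g f
      re_inner_nonneg := fun f => (Complex.nonneg_iff.1 (q.nonneg f)).1
      add_left := fun f g h => LinearMap.map_add₂ q.toFun f g h
      smul_left := fun f g c => LinearMap.map_smulₛₗ₂ q.toFun c f g }
  exact ⟨V, @InnerProductSpace.Core.toSeminormedAddCommGroup ℂ V _ _ _ c,
    @InnerProductSpace.ofCore ℂ V _ _ _ c, LinearMap.id, rfl⟩

theorem PSForm.apply_eq_zero_of_diag (q : PSForm V) (h : ∀ x, q x x = 0) (x y : V) :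
    q x y = 0 := by
  have : q = PSForm.ofMap (0 : V →ₗ[ℂ] ℂ) :=
    PSForm.ext_of_diag fun x => by rw [h x, PSForm.ofMap_apply]; simp
  rw [this, PSForm.ofMap_apply]
  simp

/-- If `u n → x` in `H` and `u` is Cauchy for the closed form `s`, then `x` is in the domain of `s`
and `s (u n, u n) → s (x, x)`. -/
theorem DenseForm.IsClosed.exists_tendsto {s : DenseForm H} (hs : s.IsClosed)
    {E : Type*} [SeminormedAddCommGroup E] {u : ℕ → s.dom} {x : H}
    (hu : Tendsto (fun n => (u n : H)) atTop (𝓝 x)) {w : ℕ → E} (hw : CauchySeq w)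
    (hle : ∀ m n, (s.form (u m - u n) (u m - u n)).re ≤ ‖w m - w n‖ ^ 2) :
    ∃ hx : x ∈ s.dom, Tendsto (fun n => (s.form (u n) (u n)).re) atTop
      (𝓝 (s.form ⟨x, hx⟩ ⟨x, hx⟩).re) := by
  obtain ⟨y, hy⟩ := hs u fun ε hε => by
    obtain ⟨N₁, h₁⟩ := Metric.cauchySeq_iff.1 hu.cauchySeq (√(ε / 2)) (by positivity)
    obtain ⟨N₂, h₂⟩ := Metric.cauchySeq_iff.1 hw (√(ε / 2)) (by positivity)
    refine ⟨max N₁ N₂, fun m hm n hn => ?_⟩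
    have a₁ := h₁ m (le_of_max_le_left hm) n (le_of_max_le_left hn)
    have a₂ := h₂ m (le_of_max_le_right hm) n (le_of_max_le_right hn)
    rw [dist_eq_norm, Real.lt_sqrt (norm_nonneg _)] at a₁ a₂
    have a₃ : ‖u m - u n‖ ^ 2 < ε / 2 := a₁
    linarith [hle m n]
  have hnn : ∀ n, 0 ≤ (s.form (u n - y) (u n - y)).re := fun n =>
    (Complex.nonneg_iff.1 (s.form.nonneg _)).1
  have hy₁ : Tendsto (fun n => ‖u n - y‖ ^ 2) atTop (𝓝 0) :=
    squeeze_zero (fun n => by positivity) (fun n => by linarith [hnn n]) hy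
  have hy₂ : Tendsto (fun n => (s.form (u n - y) (u n - y)).re) atTop (𝓝 0) :=
    squeeze_zero hnn (fun n => by linarith [sq_nonneg ‖u n - y‖]) hy
  -- The form norm dominates the norm of `H`, so its limit can only be `x`.
  have hxy : x = y := by
    refine tendsto_nhds_unique hu ?_
    rw [tendsto_iff_norm_sub_tendsto_zero]
    have := hy₁.sqrt
    simpa [Real.sqrt_sq] using this
  subst hxy
  refine ⟨y.2, ?_⟩
  -- Once the form is written as the square of a seminorm, convergence of the diagonal values is
  -- continuity of that seminorm.
  obtain ⟨F, _, _, j, hj⟩ := s.form.exists_eq_ofMap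
  simp only [hj, PSForm.re_ofMap_self] at hy₂ ⊢
  refine Tendsto.pow (Tendsto.norm ?_) 2
  rw [tendsto_iff_norm_sub_tendsto_zero]
  have := hy₂.sqrt
  simpa [Real.sqrt_sq] using this

variable {K : Type*} [NormedAddCommGroup K] [InnerProductSpace ℂ K]

/-- The form `⟪T x, T y⟫` of a densely defined operator. -/
def DenseForm.ofOp (T : H →ₗ.[ℂ] K) (hT : Dense (T.domain : Set H)) : DenseForm H where
  dom := T.domain
  dense_dom := hT
  form := PSForm.ofMap T.toFun

theorem DenseForm.ofOp_graph_norm_sub {T : H →ₗ.[ℂ] K} (hT : Dense (T.domain : Set H))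
    (x z : (DenseForm.ofOp T hT).dom) :
    ‖x - z‖ ^ 2 + ((DenseForm.ofOp T hT).form (x - z) (x - z)).re =
      ‖(x : H) - z‖ ^ 2 + ‖T x - T z‖ ^ 2 := by
  let x' : T.domain := x
  let z' : T.domain := z
  have h := PSForm.re_ofMap_self T.toFun (x' - z')
  rw [map_sub] at h
  exact congrArg (‖(x : H) - z‖ ^ 2 + ·) h

theorem DenseForm.ofOp_isClosed [CompleteSpace H] [CompleteSpace K] {T : H →ₗ.[ℂ] K}
    (hT : Dense (T.domain : Set H)) (hc : T.IsClosed) : (DenseForm.ofOp T hT).IsClosed := by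
  intro u hu
  have hu' : ∀ ε : ℝ, 0 < ε → ∃ N, ∀ m, N ≤ m → ∀ n, N ≤ n →
      ‖(u m : H) - u n‖ ^ 2 + ‖T (u m) - T (u n)‖ ^ 2 < ε := by
    intro ε hε
    simpa only [DenseForm.ofOp_graph_norm_sub] using hu ε hε
  have h₁ : CauchySeq fun n => (u n : H) := Metric.cauchySeq_iff.2 fun ε hε => by
    obtain ⟨N, hN⟩ := hu' (ε ^ 2) (by positivity)
    refine ⟨N, fun m hm n hn => ?_⟩
    rw [dist_eq_norm]
    refine lt_of_pow_lt_pow_left₀ 2 hε.le ?_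
    linarith [hN m hm n hn, sq_nonneg ‖T (u m) - T (u n)‖]
  have h₂ : CauchySeq fun n => T (u n) := Metric.cauchySeq_iff.2 fun ε hε => by
    obtain ⟨N, hN⟩ := hu' (ε ^ 2) (by positivity)
    refine ⟨N, fun m hm n hn => ?_⟩
    rw [dist_eq_norm]
    refine lt_of_pow_lt_pow_left₀ 2 hε.le ?_
    linarith [hN m hm n hn, sq_nonneg ‖(u m : H) - u n‖]
  obtain ⟨x, hx⟩ := cauchySeq_tendsto_of_complete h₁
  obtain ⟨y, hy⟩ := cauchySeq_tendsto_of_complete h₂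
  have hxy : (x, y) ∈ T.graph :=
    hc.mem_of_tendsto (hx.prodMk_nhds hy) (Eventually.of_forall fun n => T.mem_graph (u n))
  obtain ⟨z, hz₁, hz₂⟩ := T.mem_graph_iff.1 hxy
  refine ⟨z, Tendsto.congr (fun n => (DenseForm.ofOp_graph_norm_sub hT (u n) z).symm) ?_⟩
  simp only at hz₁ hz₂
  rw [hz₁, hz₂]
  have t₁ := (tendsto_iff_norm_sub_tendsto_zero.1 hx).pow 2
  have t₂ := (tendsto_iff_norm_sub_tendsto_zero.1 hy).pow 2
  simpa using t₁.add t₂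

theorem exists_seq_of_mem_closure_range {X Y W : Type*} [PseudoMetricSpace X] [PseudoMetricSpace Y]
    {f : W → X} {g : W → Y} {x : X} {y : Y}
    (h : (x, y) ∈ closure (Set.range fun w => (f w, g w))) :
    ∃ a : ℕ → W, Tendsto (fun n => f (a n)) atTop (𝓝 x) ∧ Tendsto (fun n => g (a n)) atTop (𝓝 y) := by
  obtain ⟨b, hb, hlim⟩ := mem_closure_iff_seq_limit.1 h
  choose a ha using hb
  refine ⟨a, ?_, ?_⟩
  · simpa [Function.comp_def, ← ha] using (continuous_fst.tendsto _).comp hlim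
  · simpa [Function.comp_def, ← ha] using (continuous_snd.tendsto _).comp hlim

/-- A closed form which is dominated on `V` by the form of a map `j` is dominated, on the closure of
the graph of `j`, by the norm. -/
theorem DenseForm.IsClosed.exists_le_of_mem_closure {s : DenseForm H} (hs : s.IsClosed)
    {ι : V →ₗ[ℂ] H} {E : Type*} [SeminormedAddCommGroup E] [InnerProductSpace ℂ E]
    {j : V →ₗ[ℂ] E} (hι : ∀ v, ι v ∈ s.dom)
    (hle : ∀ v, (s.form ⟨ι v, hι v⟩ ⟨ι v, hι v⟩).re ≤ ‖j v‖ ^ 2) {x : H} {y : E}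
    (hxy : (x, y) ∈ closure (Set.range fun v => (ι v, j v))) :
    ∃ hx : x ∈ s.dom, (s.form ⟨x, hx⟩ ⟨x, hx⟩).re ≤ ‖y‖ ^ 2 ∧
      ((∀ v, (s.form ⟨ι v, hι v⟩ ⟨ι v, hι v⟩).re = ‖j v‖ ^ 2) →
        (s.form ⟨x, hx⟩ ⟨x, hx⟩).re = ‖y‖ ^ 2) := by
  obtain ⟨a, ha, hja⟩ := exists_seq_of_mem_closure_range hxy
  obtain ⟨hx, hlim⟩ := hs.exists_tendsto (u := fun n => ⟨ι (a n), hι (a n)⟩) ha hja.cauchySeq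
    fun m n => by
      have h : (⟨ι (a m), hι (a m)⟩ - ⟨ι (a n), hι (a n)⟩ : s.dom) =
          ⟨ι (a m - a n), hι (a m - a n)⟩ := Subtype.ext (map_sub ι _ _).symm
      rw [← map_sub, h]
      exact hle _
  exact ⟨hx, le_of_tendsto_of_tendsto' hlim (hja.norm.pow 2) fun n => hle (a n), fun h =>
    tendsto_nhds_unique hlim (by simpa only [h] using hja.norm.pow 2)⟩

/-- The hypothesis `hcore` says that the image of `V` is a core of `T`. Each point of the graph of
`T` is then a limit of pairs `(ι v, j v)`, so any closed extension is defined there and takes the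
value `‖T x‖²`. Polarization gives agreement off the diagonal. -/
theorem DenseForm.isClosureOf_ofOp [CompleteSpace H] [CompleteSpace K] {T : H →ₗ.[ℂ] K}
    (hT : Dense (T.domain : Set H)) (hc : T.IsClosed) {ι : V →ₗ[ℂ] H} {j : V →ₗ[ℂ] K}
    (hj : ∀ v, (ι v, j v) ∈ T.graph)
    (hcore : ∀ p ∈ T.graph, p ∈ closure (Set.range fun v => (ι v, j v))) :
    (DenseForm.ofOp T hT).IsClosureOf ι (PSForm.ofMap j) := by
  have hj' : ∀ v, ∃ h : ι v ∈ T.domain, T ⟨ι v, h⟩ = j v := fun v => by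
    obtain ⟨z, hz₁, hz₂⟩ := T.mem_graph_iff.1 (hj v)
    simp only at hz₁ hz₂
    exact ⟨hz₁ ▸ z.2, by rw [← hz₂]; congr 1; exact Subtype.ext hz₁.symm⟩
  choose hι hιj using hj'
  refine ⟨DenseForm.ofOp_isClosed hT hc, ⟨hι, fun v w => ?_⟩, fun s hs ⟨h, hsq⟩ => ?_⟩
  · change ⟪T ⟨ι v, _⟩, T ⟨ι w, _⟩⟫_ℂ = ⟪j v, j w⟫_ℂ
    rw [hιj, hιj]
  · have hs' : ∀ v, (s.form ⟨ι v, h v⟩ ⟨ι v, h v⟩).re = ‖j v‖ ^ 2 := fun v => by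
      rw [hsq, PSForm.re_ofMap_self]
    have key : ∀ x : T.domain, ∃ hx : (x : H) ∈ s.dom,
        (s.form ⟨x, hx⟩ ⟨x, hx⟩).re = ‖T x‖ ^ 2 := fun x => by
      obtain ⟨hx, -, h'⟩ := hs.exists_le_of_mem_closure h (fun v => (hs' v).le)
        (hcore _ (T.mem_graph x))
      exact ⟨hx, h' hs'⟩
    choose hd hk using key
    refine ⟨hd, fun v w => ?_⟩
    have := PSForm.ext_of_diag (p := s.form.comap (Submodule.inclusion (show T.domain ≤ s.dom from
      fun x hx => hd ⟨x, hx⟩))) (q := PSForm.ofMap T.toFun) fun x => PSForm.diag_eq_of_re <| by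
        rw [PSForm.re_ofMap_self]; exact hk x
    exact congrArg (fun q : PSForm T.domain => q v w) this

end FormLemmas

/-! ### Operators through their graphs; the resolvent of `T* T` -/

section GraphLemmas

theorem mem_opComp_graph {E F G : Type*} [AddCommGroup E] [Module ℂ E] [AddCommGroup F]
    [Module ℂ F] [AddCommGroup G] [Module ℂ G] (B : F →ₗ.[ℂ] G) (A : E →ₗ.[ℂ] F) (x : E) (z : G) :
    (x, z) ∈ (opComp B A).graph ↔ ∃ y, (x, y) ∈ A.graph ∧ (y, z) ∈ B.graph := by
  constructor
  · intro h
    obtain ⟨⟨x', hx'⟩, h₁, h₂⟩ := (LinearPMap.mem_graph_iff _).1 h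
    simp only at h₁ h₂
    subst h₁
    obtain ⟨hA, hB⟩ := (mem_opComp_domain B A x').1 hx'
    rw [opComp_apply B A x' hA hB hx'] at h₂
    exact ⟨_, A.mem_graph ⟨x', hA⟩, h₂ ▸ B.mem_graph ⟨_, hB⟩⟩
  · rintro ⟨y, h₁, h₂⟩
    obtain ⟨⟨x', hx'⟩, h₁, rfl⟩ := (LinearPMap.mem_graph_iff _).1 h₁
    simp only at h₁ h₂
    subst h₁
    obtain ⟨⟨y', hy'⟩, h₁, rfl⟩ := (LinearPMap.mem_graph_iff _).1 h₂
    simp only at h₁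
    subst h₁
    have hx : x' ∈ (opComp B A).domain := (mem_opComp_domain B A x').2 ⟨hx', hy'⟩
    rw [← opComp_apply B A x' hx' hy' hx]
    exact (opComp B A).mem_graph ⟨x', hx⟩

theorem mem_toPMap_top_graph {E F : Type*} [AddCommGroup E] [Module ℂ E] [AddCommGroup F]
    [Module ℂ F] (A : E →ₗ[ℂ] F) (x : E) (y : F) : (x, y) ∈ (A.toPMap ⊤).graph ↔ A x = y := by
  rw [LinearPMap.mem_graph_iff]
  constructor
  · rintro ⟨z, h₁, h₂⟩
    simp only at h₁ h₂
    rw [← h₁, ← h₂]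
    rfl
  · rintro rfl
    exact ⟨⟨x, trivial⟩, rfl, rfl⟩

theorem exists_apply_eq_of_mem_graph {E F : Type*} [AddCommGroup E] [Module ℂ E] [AddCommGroup F]
    [Module ℂ F] {A : E →ₗ.[ℂ] F} {x : E} {y : F} (h : (x, y) ∈ A.graph) :
    ∃ hx : x ∈ A.domain, A ⟨x, hx⟩ = y := by
  obtain ⟨⟨z, hz⟩, h₁, h₂⟩ := A.mem_graph_iff.1 h
  simp only at h₁ h₂
  subst h₁
  exact ⟨hz, h₂⟩

variable {H : Type*} [NormedAddCommGroup H] [InnerProductSpace ℂ H] [CompleteSpace H]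
variable {K : Type*} [NormedAddCommGroup K] [InnerProductSpace ℂ K]

theorem mem_adjoint_graph_iff {T : H →ₗ.[ℂ] K} (hT : Dense (T.domain : Set H)) (y : K) (w : H) :
    (y, w) ∈ T.adjoint.graph ↔ ∀ p ∈ T.graph, ⟪w, p.1⟫_ℂ = ⟪y, p.2⟫_ℂ := by
  constructor
  · rintro h ⟨a, b⟩ hab
    obtain ⟨ha, rfl⟩ := exists_apply_eq_of_mem_graph hab
    obtain ⟨hy, rfl⟩ := exists_apply_eq_of_mem_graph h
    exact LinearPMap.adjoint_isFormalAdjoint hT ⟨y, hy⟩ ⟨a, ha⟩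
  · intro h
    have h' : ∀ x : T.domain, ⟪w, (x : H)⟫_ℂ = ⟪y, T x⟫_ℂ := fun x => h _ (T.mem_graph x)
    have hy := LinearPMap.mem_adjoint_domain_of_exists y ⟨w, h'⟩
    rw [← LinearPMap.adjoint_apply_eq hT ⟨y, hy⟩ h']
    exact T.adjoint.mem_graph ⟨y, hy⟩

variable [CompleteSpace K]

/-- Orthogonal decomposition of `H × K` with respect to a subspace. -/
theorem exists_sub_orthogonal (N : Submodule ℂ (H × K)) (p : H × K) :
    ∃ c : H × K, c ∈ N.topologicalClosure ∧ ∀ q ∈ N.topologicalClosure,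
      ⟪q.1, (p - c).1⟫_ℂ + ⟪q.2, (p - c).2⟫_ℂ = 0 := by
  -- The product carries the supremum norm. The `ℓ²` product has the same topology and makes
  -- orthogonal projection available.
  let e := WithLp.prodContinuousLinearEquiv 2 ℂ H K
  let M : Submodule ℂ (WithLp 2 (H × K)) := N.topologicalClosure.comap e.toLinearMap
  have hM : IsClosed (M : Set (WithLp 2 (H × K))) :=
    N.isClosed_topologicalClosure.preimage e.continuous
  have : CompleteSpace M := hM.completeSpace_coe
  refine ⟨e (M.starProjection (e.symm p)), M.starProjection_apply_mem _, fun q hq => ?_⟩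
  have hq' : e.symm q ∈ M := by
    change e (e.symm q) ∈ N.topologicalClosure
    rwa [e.apply_symm_apply]
  have h := M.sub_starProjection_mem_orthogonal (e.symm p) _ hq'
  rw [WithLp.prod_inner_apply] at h
  exact h

/-- The operator `R = (1 + T* T)⁻¹`. -/
theorem exists_resolvent {T : H →ₗ.[ℂ] K} (hT : Dense (T.domain : Set H)) (hc : T.IsClosed) :
    ∃ R : H →L[ℂ] H, 0 ≤ R ∧ R ≤ 1 ∧ ∀ x w,
      (∃ y, (x, y) ∈ T.graph ∧ (y, w) ∈ T.adjoint.graph) ↔ R (x + w) = x := by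
  let e := WithLp.prodContinuousLinearEquiv 2 ℂ H K
  let M : Submodule ℂ (WithLp 2 (H × K)) := T.graph.comap e.toLinearMap
  have hM : IsClosed (M : Set (WithLp 2 (H × K))) := hc.preimage e.continuous
  have : CompleteSpace M := hM.completeSpace_coe
  let I : H →L[ℂ] WithLp 2 (H × K) :=
    (e.symm : H × K →L[ℂ] WithLp 2 (H × K)).comp (ContinuousLinearMap.inl ℂ H K)
  have hI : ∀ x, I x = WithLp.toLp 2 (x, 0) := fun x => rfl
  have hII : ∀ p, I.adjoint p = p.fst := fun p =>
    ext_inner_left ℂ fun v => by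
      rw [ContinuousLinearMap.adjoint_inner_right, hI, WithLp.prod_inner_apply]
      simp
  -- `R` is the compression to `H` of the projection onto the graph of `T`. It works because `(x +
  -- w, 0) = (x, y) + (w, -y)` splits along the graph and its complement exactly when `y = T x` and
  -- `w = T* y`.
  let R : H →L[ℂ] H := I.adjoint ∘L M.starProjection ∘L I
  have hR : ∀ u, R u = (M.starProjection (WithLp.toLp 2 (u, 0))).fst := fun u => hII _
  have hperp : ∀ a b, WithLp.toLp 2 (a, b) ∈ Mᗮ ↔ ∀ p ∈ T.graph, ⟪p.1, a⟫_ℂ + ⟪p.2, b⟫_ℂ = 0 := by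
    intro a b
    rw [Submodule.mem_orthogonal]
    constructor
    · intro h p hp
      have := h (e.symm p) (show e (e.symm p) ∈ T.graph by rwa [e.apply_symm_apply])
      rwa [WithLp.prod_inner_apply] at this
    · intro h u hu
      rw [WithLp.prod_inner_apply]
      exact h _ hu
  have hadj : ∀ y w, (y, w) ∈ T.adjoint.graph ↔ WithLp.toLp 2 (w, -y) ∈ Mᗮ := by
    intro y w
    rw [mem_adjoint_graph_iff hT, hperp]
    refine forall₂_congr fun p _ => ?_
    rw [inner_neg_right, add_neg_eq_zero, ← inner_conj_symm, ← inner_conj_symm y,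
      (starRingEnd ℂ).injective.eq_iff]
  refine ⟨R, ?_, ?_, fun x w => ⟨?_, fun h => ?_⟩⟩
  · rw [ContinuousLinearMap.nonneg_iff_isPositive]
    exact ContinuousLinearMap.IsPositive.adjoint_conj
      (ContinuousLinearMap.IsPositive.of_isStarProjection isStarProjection_starProjection) I
  · rw [ContinuousLinearMap.le_def]
    -- Since `I* I = 1`, `1 - R` is the compression of the complementary projection, hence positive.
    have h : (1 : H →L[ℂ] H) - R = I.adjoint ∘L Mᗮ.starProjection ∘L I := by
      ext u
      change u - I.adjoint (M.starProjection (I u)) = I.adjoint (Mᗮ.starProjection (I u))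
      rw [Submodule.starProjection_orthogonal_val, map_sub, hII (I u)]
      rfl
    rw [h]
    exact ContinuousLinearMap.IsPositive.adjoint_conj
      (ContinuousLinearMap.IsPositive.of_isStarProjection isStarProjection_starProjection) I
  · rintro ⟨y, h₁, h₂⟩
    rw [hR]
    have h₃ : M.starProjection (WithLp.toLp 2 (x + w, 0)) = WithLp.toLp 2 (x, y) := by
      refine Submodule.eq_starProjection_of_mem_orthogonal (K := M) h₁ ?_
      rw [← WithLp.toLp_sub]
      simpa using (hadj y w).1 h₂
    exact congrArg WithLp.fst h₃
  · rw [hR] at h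
    set p := M.starProjection (WithLp.toLp 2 (x + w, 0)) with hp
    have hpM : p ∈ M := M.starProjection_apply_mem _
    have hpo : WithLp.toLp 2 (x + w, 0) - p ∈ Mᗮ := M.sub_starProjection_mem_orthogonal _
    have hpe : p = WithLp.toLp 2 (x, p.snd) := by
      rw [← h]; rfl
    refine ⟨p.snd, ?_, ?_⟩
    · rw [hpe] at hpM
      exact hpM
    · rw [hadj]
      rw [hpe, ← WithLp.toLp_sub] at hpo
      simpa using hpo

end GraphLemmas

/-! ### Self-adjointness of `T* T` and its square root -/

section SquareRoot

variable {H : Type*} [NormedAddCommGroup H] [InnerProductSpace ℂ H] [CompleteSpace H]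

theorem isPositive_dense_range_of_injective {R : H →L[ℂ] H} (hR : R.IsPositive)
    (hinj : ∀ x, R x = 0 → x = 0) : Dense ((LinearMap.range R.toLinearMap : Submodule ℂ H) : Set H) := by
  rw [Submodule.dense_iff_topologicalClosure_eq_top, Submodule.topologicalClosure_eq_top_iff,
    Submodule.eq_bot_iff]
  intro v hv
  refine hinj v (ext_inner_left ℂ fun x => ?_)
  rw [← hR.inner_left_eq_inner_right, inner_zero_right]
  exact hv _ ⟨x, rfl⟩

theorem adjoint_eq_of_graph {A : H →ₗ.[ℂ] H} (hA : Dense (A.domain : Set H))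
    (h : ∀ y w, (∀ p ∈ A.graph, ⟪w, p.1⟫_ℂ = ⟪y, p.2⟫_ℂ) ↔ (y, w) ∈ A.graph) : A.adjoint = A := by
  refine LinearPMap.eq_of_eq_graph (SetLike.ext ?_)
  rintro ⟨y, w⟩
  rw [mem_adjoint_graph_iff hA, h]

/-- If `C² + B² = 1` with commuting positive `C`, `B`, and `C` is injective, then `B C⁻¹` is
self-adjoint. -/
theorem exists_isPosSelfAdjoint_graph {B C : H →L[ℂ] H} (hB : 0 ≤ B) (hC : 0 ≤ C)
    (hBC : Commute B C) (hinj : ∀ x, C x = 0 → x = 0) (hone : ∀ x, C (C x) + B (B x) = x) :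
    ∃ S : H →ₗ.[ℂ] H, IsPosSelfAdjoint S ∧
      ∀ a b, (a, b) ∈ S.graph ↔ ∃ x, C x = a ∧ B x = b := by
  have hcomm : ∀ x, B (C x) = C (B x) := fun x => congrArg (fun F : H →L[ℂ] H => F x) hBC.eq
  have hCB : 0 ≤ C * B := Commute.mul_nonneg hC hB hBC.symm
  rw [ContinuousLinearMap.nonneg_iff_isPositive] at hB hC hCB
  have hC' : Function.Injective C.toLinearMap := (injective_iff_map_eq_zero _).2 hinj
  let S : H →ₗ.[ℂ] H := ⟨LinearMap.range C.toLinearMap,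
    B.toLinearMap ∘ₗ (LinearEquiv.ofInjective C.toLinearMap hC').symm.toLinearMap⟩
  have hS : ∀ a b, (a, b) ∈ S.graph ↔ ∃ x, C x = a ∧ B x = b := by
    intro a b
    have happ : ∀ x, S ⟨C x, x, rfl⟩ = B x := fun x =>
      congrArg B ((LinearEquiv.ofInjective C.toLinearMap hC').symm_apply_apply x)
    constructor
    · intro h
      obtain ⟨⟨x, rfl⟩, rfl⟩ := exists_apply_eq_of_mem_graph h
      exact ⟨x, rfl, (happ x).symm⟩
    · rintro ⟨x, rfl, rfl⟩
      rw [← happ]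
      exact S.mem_graph ⟨C x, x, rfl⟩
  have hdense : Dense (S.domain : Set H) := isPositive_dense_range_of_injective hC hinj
  refine ⟨S, ⟨hdense, adjoint_eq_of_graph hdense fun y w => ?_, fun x => ?_⟩, hS⟩
  · rw [hS]
    constructor
    · intro h
      have e : C w = B y := ext_inner_right ℂ fun x => by
        rw [hC.inner_left_eq_inner_right, hB.inner_left_eq_inner_right]
        exact h _ ((hS _ _).2 ⟨x, rfl, rfl⟩)
      -- The witness is forced: `C x = y` and `B x = w` imply `x = C (C x) + B (B x) = C y + B w`.
      refine ⟨C y + B w, ?_, ?_⟩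
      · rw [map_add, ← hcomm, e, hone]
      · rw [map_add, hcomm, ← e, hone]
    · rintro ⟨x, rfl, rfl⟩ ⟨a, b⟩ hab
      obtain ⟨z, rfl, rfl⟩ := (hS _ _).1 hab
      rw [hB.inner_left_eq_inner_right, hC.inner_left_eq_inner_right, hcomm]
  · obtain ⟨z, h₁, h₂⟩ := (hS _ _).1 (S.mem_graph x)
    rw [← h₁, ← h₂, hC.inner_left_eq_inner_right]
    exact hCB.inner_nonneg_right z

variable {K : Type*} [NormedAddCommGroup K] [InnerProductSpace ℂ K] [CompleteSpace K]

/-- The domain of `T* T` is a core of the closed operator `T`. -/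
theorem mem_closure_of_mem_graph {T : H →ₗ.[ℂ] K} (hT : Dense (T.domain : Set H))
    (hc : T.IsClosed) {A : H →ₗ.[ℂ] H}
    (hA : ∀ x w, (x, w) ∈ A.graph ↔ ∃ y, (x, y) ∈ T.graph ∧ (y, w) ∈ T.adjoint.graph)
    (j : A.domain →ₗ[ℂ] K) (hj : ∀ v : A.domain, ((v : H), j v) ∈ T.graph) :
    ∀ p ∈ T.graph, p ∈ closure (Set.range fun v : A.domain => (A.domain.subtype v, j v)) := by
  obtain ⟨R, -, -, hR⟩ := exists_resolvent hT hc
  intro p hp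
  obtain ⟨c, hcN, hc'⟩ := exists_sub_orthogonal (LinearMap.range (A.domain.subtype.prod j)) p
  have hle : LinearMap.range (A.domain.subtype.prod j) ≤ T.graph := by
    rintro _ ⟨v, rfl⟩
    exact hj v
  have hr : p - c ∈ T.graph :=
    T.graph.sub_mem hp (Submodule.topologicalClosure_minimal _ hle hc hcN)
  -- The remainder `r = p - c` lies in the graph of `T` and is orthogonal to every `(R u, T R u)`.
  -- Moving `T` across turns this into `⟪R u + T* T R u, r.1⟫ = ⟪u, r.1⟫ = 0` for every `u`.
  have h₁ : (p - c).1 = 0 := by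
    refine ext_inner_left ℂ fun u => ?_
    obtain ⟨y, hy, hw⟩ := (hR (R u) (u - R u)).2 (by rw [add_sub_cancel])
    obtain ⟨hv, -⟩ := exists_apply_eq_of_mem_graph ((hA _ _).2 ⟨y, hy, hw⟩)
    have hjy : j ⟨R u, hv⟩ = y := T.mem_graph_snd_inj (hj ⟨R u, hv⟩) hy rfl
    have e₁ := hc' _ (Submodule.le_topologicalClosure _ ⟨⟨R u, hv⟩, rfl⟩)
    have e₂ := (mem_adjoint_graph_iff hT _ _).1 hw _ hr
    change ⟪R u, (p - c).1⟫_ℂ + ⟪j ⟨R u, hv⟩, (p - c).2⟫_ℂ = 0 at e₁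
    rw [hjy, ← e₂, ← inner_add_left, add_sub_cancel] at e₁
    rw [e₁, inner_zero_right]
  have h₂ : (p - c).2 = 0 := T.graph_fst_eq_zero_snd hr h₁
  have hpc : p = c := sub_eq_zero.1 (Prod.ext h₁ h₂)
  rw [hpc]
  exact hcN

/-- For a closed operator `T`, the operator `T* T` is self-adjoint and its form is `⟪T x, T y⟫`. -/
theorem DenseForm.ofOp_isFormOf {T : H →ₗ.[ℂ] K} (hT : Dense (T.domain : Set H))
    (hc : T.IsClosed) {A : H →ₗ.[ℂ] H}
    (hA : ∀ x w, (x, w) ∈ A.graph ↔ ∃ y, (x, y) ∈ T.graph ∧ (y, w) ∈ T.adjoint.graph) :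
    (DenseForm.ofOp T hT).IsFormOf A := by
  obtain ⟨R, hR₀, hR₁, hR⟩ := exists_resolvent hT hc
  have hAR : ∀ x w, (x, w) ∈ A.graph ↔ R (x + w) = x := fun x w => (hA x w).trans (hR x w)
  have hRp := (ContinuousLinearMap.nonneg_iff_isPositive R).1 hR₀
  have hRinj : ∀ x, R x = 0 → x = 0 := fun x hx =>
    A.graph_fst_eq_zero_snd ((hAR 0 x).2 (by rw [zero_add, hx])) rfl
  have hmem : ∀ u, (R u, u - R u) ∈ A.graph := fun u => (hAR _ _).2 (by rw [add_sub_cancel])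
  have hAdense : Dense (A.domain : Set H) := by
    refine (isPositive_dense_range_of_injective hRp hRinj).mono ?_
    rintro _ ⟨u, rfl⟩
    exact (exists_apply_eq_of_mem_graph (hmem u)).1
  have hApos : IsPosSelfAdjoint A := by
    refine ⟨hAdense, adjoint_eq_of_graph hAdense fun y w => ?_, fun x => ?_⟩
    · rw [hAR]
      constructor
      · intro h
        refine ext_inner_right ℂ fun u => ?_
        have := h _ (hmem u)
        rw [inner_sub_right] at this
        rw [map_add, inner_add_left, hRp.inner_left_eq_inner_right, hRp.inner_left_eq_inner_right,
          this]
        ring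
      · rintro h ⟨a, b⟩ hab
        have h' := (hAR _ _).1 hab
        have e := hRp.inner_left_eq_inner_right (y + w) (a + b)
        rw [h, h', inner_add_left, inner_add_right] at e
        exact (add_left_cancel e).symm
    · obtain ⟨y, hy, hw⟩ := (hA _ _).1 (A.mem_graph x)
      have e := (mem_adjoint_graph_iff hT _ _).1 hw _ hy
      rw [← inner_conj_symm, e, inner_conj_symm]
      exact Complex.nonneg_iff.2 ⟨inner_self_nonneg (𝕜 := ℂ), (inner_self_im (𝕜 := ℂ) _).symm⟩
  have hR₂ : 0 ≤ 1 - R := sub_nonneg.2 hR₁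
  have hCC : ∀ x, CFC.sqrt R (CFC.sqrt R x) = R x := fun x =>
    congrArg (fun F : H →L[ℂ] H => F x) (CFC.sqrt_mul_sqrt_self R hR₀)
  have hBB : ∀ x, CFC.sqrt (1 - R) (CFC.sqrt (1 - R) x) = x - R x := fun x =>
    congrArg (fun F : H →L[ℂ] H => F x) (CFC.sqrt_mul_sqrt_self (1 - R) hR₂)
  have hBC : Commute (CFC.sqrt (1 - R)) (CFC.sqrt R) := by
    have h₁ : Commute R (1 - R) := (Commute.one_right R).sub_right (Commute.refl R)
    exact ((h₁.cfcₙ_nnreal NNReal.sqrt).symm.cfcₙ_nnreal NNReal.sqrt)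
  have hcomm : ∀ x, CFC.sqrt (1 - R) (CFC.sqrt R x) = CFC.sqrt R (CFC.sqrt (1 - R) x) := fun x =>
    congrArg (fun F : H →L[ℂ] H => F x) hBC.eq
  -- From `R = (1 + A)⁻¹` one has `A = (1 - R) R⁻¹`, so the root must be `S = (1 - R)^{1/2}
  -- R^{-1/2}`.
  obtain ⟨S, hS, hSg⟩ := exists_isPosSelfAdjoint_graph (CFC.sqrt_nonneg (1 - R))
    (CFC.sqrt_nonneg R) hBC (fun x hx => hRinj x (by rw [← hCC, hx, map_zero]))
    (fun x => by rw [hCC, hBB, add_sub_cancel])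
  have hSA : ∀ a b, (a, b) ∈ A.graph ↔ ∃ c, (a, c) ∈ S.graph ∧ (c, b) ∈ S.graph := by
    intro a b
    simp only [hAR, hSg]
    constructor
    · intro h
      -- With `u = a + b` one has `a = R u` and `b = (1 - R) u`, and the intermediate vector is `S a
      -- = (1 - R)^{1/2} R^{1/2} u`.
      refine ⟨CFC.sqrt (1 - R) (CFC.sqrt R (a + b)), ⟨_, by rw [hCC, h], rfl⟩,
        CFC.sqrt (1 - R) (a + b), (hcomm _).symm, ?_⟩
      rw [hBB, h, add_sub_cancel_left]
    · rintro ⟨c, ⟨x, hxa, hxc⟩, y, hyc, hyb⟩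
      rw [← hCC, map_add (CFC.sqrt R), ← hxa, ← hyb, hCC, ← hcomm, hyc, ← hxc, hBB, add_sub_cancel]
  have hSc : S.IsClosed := IsSelfAdjoint.isClosed (LinearPMap.isSelfAdjoint_def.2 hS.adjoint_eq)
  have hjT : ∀ v : A.domain, ∃ h : (v : H) ∈ T.domain, (T ⟨v, h⟩, A v) ∈ T.adjoint.graph := by
    intro v
    obtain ⟨y, hy, hw⟩ := (hA _ _).1 (A.mem_graph v)
    obtain ⟨h, rfl⟩ := exists_apply_eq_of_mem_graph hy
    exact ⟨h, hw⟩
  have hjS : ∀ v : A.domain, ∃ h : (v : H) ∈ S.domain, (S ⟨v, h⟩, A v) ∈ S.adjoint.graph := by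
    intro v
    obtain ⟨y, hy, hw⟩ := (hSA _ _).1 (A.mem_graph v)
    obtain ⟨h, rfl⟩ := exists_apply_eq_of_mem_graph hy
    exact ⟨h, by rwa [hS.adjoint_eq]⟩
  let jT : A.domain →ₗ[ℂ] K := T.toFun ∘ₗ Submodule.inclusion fun v hv => (hjT ⟨v, hv⟩).1
  let jS : A.domain →ₗ[ℂ] H := S.toFun ∘ₗ Submodule.inclusion fun v hv => (hjS ⟨v, hv⟩).1
  have hjTg : ∀ v : A.domain, ((v : H), jT v) ∈ T.graph := fun v => T.mem_graph ⟨v, (hjT v).1⟩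
  have hjSg : ∀ v : A.domain, ((v : H), jS v) ∈ S.graph := fun v => S.mem_graph ⟨v, (hjS v).1⟩
  -- Both diagonals equal `⟪A v, v⟫`, because `T* T = A = S S`.
  have hq : PSForm.ofMap jT = PSForm.ofMap jS := PSForm.ext_of_diag fun v =>
    ((mem_adjoint_graph_iff hT _ _).1 (hjT v).2 _ (hjTg v)).symm.trans
      ((mem_adjoint_graph_iff hS.dense_domain _ _).1 (hjS v).2 _ (hjSg v))
  have cT := DenseForm.isClosureOf_ofOp hT hc hjTg (mem_closure_of_mem_graph hT hc hA jT hjTg)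
  have cS := DenseForm.isClosureOf_ofOp hS.dense_domain hSc hjSg
    (mem_closure_of_mem_graph hS.dense_domain hSc (by rwa [hS.adjoint_eq]) jS hjSg)
  rw [← hq] at cS
  -- The forms of `T` and `S` are both closures of the same form on `Dom A`, so minimality in both
  -- directions identifies them.
  obtain ⟨h₁, -⟩ := cS.2.2 _ cT.1 cT.2.1
  obtain ⟨h₂, h₃⟩ := cT.2.2 _ cS.1 cS.2.1
  refine ⟨hApos, S, hS, LinearPMap.eq_of_eq_graph (SetLike.ext ?_),
    le_antisymm (fun x hx => h₂ ⟨x, hx⟩) (fun x hx => h₁ ⟨x, hx⟩), fun x y => (h₃ x y).symm⟩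
  rintro ⟨a, b⟩
  rw [mem_opComp_graph, hSA]

end SquareRoot

/-! ### Uniqueness and an abstract construction of the Simon–Lebesgue decomposition -/

section SimonLebesgue

variable {H : Type*} [NormedAddCommGroup H] [InnerProductSpace ℂ H]
variable {V : Type*} [AddCommGroup V] [Module ℂ V]

/-- A closed extension of `p₁` is itself a closeable form below `q`, so the maximality of `p₂`
applies to it. -/
theorem IsSimonLebesgue.ac_unique_le {ι : V →ₗ[ℂ] H} {q p₁ s₁ p₂ s₂ : PSForm V}
    (h₁ : IsSimonLebesgue ι q p₁ s₁) (h₂ : IsSimonLebesgue ι q p₂ s₂) (v : V) :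
    p₁ v v ≤ p₂ v v := by
  obtain ⟨t, ht, hd, hv⟩ := h₁.closeable
  obtain ⟨_, hle⟩ := h₂.maximal t ⟨t, ht, fun v => v.2, fun _ _ => rfl⟩
    ⟨hd, fun v => (hv v v).trans_le (h₁.ac_le v)⟩
  exact (hv v v).symm.trans_le (hle v)

theorem IsSimonLebesgue.unique {ι : V →ₗ[ℂ] H} {q p₁ s₁ p₂ s₂ : PSForm V}
    (h₁ : IsSimonLebesgue ι q p₁ s₁) (h₂ : IsSimonLebesgue ι q p₂ s₂) : p₁ = p₂ ∧ s₁ = s₂ := by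
  have h : p₁ = p₂ :=
    PSForm.ext_of_diag fun v => le_antisymm (h₁.ac_unique_le h₂ v) (h₂.ac_unique_le h₁ v)
  refine ⟨h, PSForm.ext_of_diag fun v => ?_⟩
  have e₁ := h₁.add_eq v v
  rw [h₂.add_eq v v, h] at e₁
  exact (add_left_cancel e₁).symm

theorem PSForm.le_of_re_le {W : Type*} [AddCommGroup W] [Module ℂ W] {p : PSForm W} {q : PSForm V}
    {x : W} {v : V} (h : (p x x).re ≤ (q v v).re) : p x x ≤ q v v :=
  Complex.le_def.2 ⟨h, by
    rw [← (Complex.nonneg_iff.1 (p.nonneg x)).2, ← (Complex.nonneg_iff.1 (q.nonneg v)).2]⟩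

variable [CompleteSpace H]
variable {E : Type*} [NormedAddCommGroup E] [InnerProductSpace ℂ E]
  (K : Submodule ℂ E) [CompleteSpace K]

/-- The geometric core: `hj` and `hcl` put `(ι v, P j v)` in the closure of the pairs `(ι w, j w)`,
where `P` projects onto `K`. This bounds every closeable form below `‖j v‖²` by `‖P j v‖²`, while
applying `1 - P` to the same limits leaves only the value zero for the singular part. -/
theorem isSimonLebesgue_ofMap {ι : V →ₗ[ℂ] H} (hι : DenseRange ι) {j : V →ₗ[ℂ] E}
    {T : H →ₗ.[ℂ] K} (hT : Dense (T.domain : Set H)) (hc : T.IsClosed)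
    (hj : ∀ v, (ι v, K.orthogonalProjectionOnto (j v)) ∈ T.graph)
    (hcl : ∀ p ∈ T.graph, (p.1, (p.2 : E)) ∈ closure (Set.range fun v => (ι v, j v))) :
    IsSimonLebesgue ι (PSForm.ofMap j) (PSForm.ofMap (K.orthogonalProjectionOnto.toLinearMap ∘ₗ j))
      (PSForm.ofMap (Kᗮ.orthogonalProjectionOnto.toLinearMap ∘ₗ j)) ∧
    (DenseForm.ofOp T hT).IsClosureOf ι
      (PSForm.ofMap (K.orthogonalProjectionOnto.toLinearMap ∘ₗ j)) := by
  have himg : ∀ {X : Type _} [TopologicalSpace X] (f : E → X), Continuous f → ∀ p ∈ T.graph,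
      (p.1, f p.2) ∈ closure (Set.range fun v => (ι v, f (j v))) := by
    intro X _ f hf p hp
    have hg : Continuous fun p : H × E => (p.1, f p.2) := by fun_prop
    have := image_closure_subset_closure_image hg ⟨_, hcl p hp, rfl⟩
    rwa [← Set.range_comp] at this
  have hclos : (DenseForm.ofOp T hT).IsClosureOf ι
      (PSForm.ofMap (K.orthogonalProjectionOnto.toLinearMap ∘ₗ j)) := by
    refine DenseForm.isClosureOf_ofOp hT hc hj fun p hp => ?_
    have := himg K.orthogonalProjectionOnto K.orthogonalProjectionOnto.continuous p hp
    rwa [Submodule.orthogonalProjectionOnto_mem_subspace_eq_self] at this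
  refine ⟨⟨fun v w => ?_, ⟨_, hclos.1, hclos.2.1⟩, ?_, ?_⟩, hclos⟩
  · change ⟪j v, j w⟫_ℂ = ⟪(K.starProjection (j v)), K.starProjection (j w)⟫_ℂ +
      ⟪Kᗮ.starProjection (j v), Kᗮ.starProjection (j w)⟫_ℂ
    have hw := K.starProjection_add_starProjection_orthogonal (j w)
    have hv := K.starProjection_add_starProjection_orthogonal (j v)
    have o₁ : ⟪K.starProjection (j v), Kᗮ.starProjection (j w)⟫_ℂ = 0 :=
      Kᗮ.starProjection_apply_mem (j w) _ (K.starProjection_apply_mem (j v))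
    have o₂ : ⟪Kᗮ.starProjection (j v), K.starProjection (j w)⟫_ℂ = 0 :=
      inner_eq_zero_symm.1
        (Kᗮ.starProjection_apply_mem (j v) _ (K.starProjection_apply_mem (j w)))
    conv_lhs => rw [← hw, ← hv]
    rw [inner_add_left, inner_add_right, inner_add_right, o₁, o₂]
    ring
  · rintro p ⟨s, hs, hd, hsp⟩ ⟨hp, hle⟩
    refine ⟨hp, fun v => ?_⟩
    -- Approximating `(ι v, P j v)` by pairs `(ι w, j w)` improves the bound from `‖j v‖²` to `‖P j
    -- v‖²`.
    obtain ⟨hx, h, -⟩ := hs.exists_le_of_mem_closure (ι := ι) (j := j) (fun v => hd ⟨_, hp v⟩)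
      (fun v => by
        have := (Complex.le_def.1 (hle v)).1
        rw [← hsp, PSForm.re_ofMap_self] at this
        exact this) (hcl _ (hj v))
    refine PSForm.le_of_re_le ?_
    rw [← hsp, PSForm.re_ofMap_self]
    exact h
  · rintro p ⟨s, hs, hd, hsp⟩ ⟨hp, hle⟩
    -- For `x = ι v` this holds because `(1 - P) P j v = 0`; density of the range of `ι` gives the
    -- rest. A closed form below `‖(1 - P) j v‖²` is therefore bounded by `0` at every `x`.
    have hz : ∀ x : H, (x, (0 : Kᗮ)) ∈
        closure (Set.range fun v => (ι v, Kᗮ.orthogonalProjectionOnto (j v))) := by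
      have hcl' : IsClosed {x : H | (x, (0 : Kᗮ)) ∈
          closure (Set.range fun v => (ι v, Kᗮ.orthogonalProjectionOnto (j v)))} :=
        isClosed_closure.preimage (by fun_prop)
      intro x
      refine hcl'.closure_subset_iff.2 ?_ (hι x)
      rintro _ ⟨v, rfl⟩
      have := himg Kᗮ.orthogonalProjectionOnto Kᗮ.orthogonalProjectionOnto.continuous _ (hj v)
      rwa [Submodule.orthogonalProjectionOnto_orthogonal_apply_eq_zero
        (Submodule.coe_mem _)] at this
    refine p.form.apply_eq_zero_of_diag fun x => ?_
    obtain ⟨hx, h, -⟩ := hs.exists_le_of_mem_closure (ι := ι)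
      (j := Kᗮ.orthogonalProjectionOnto.toLinearMap ∘ₗ j) (fun v => hd ⟨_, hp v⟩)
      (fun v => by
        have := (Complex.le_def.1 (hle v)).1
        rw [← hsp, PSForm.re_ofMap_self] at this
        exact this) (hz x)
    rw [norm_zero, zero_pow two_ne_zero] at h
    refine le_antisymm (Complex.le_def.2 ⟨?_, (Complex.nonneg_iff.1 (p.form.nonneg x)).2.symm⟩)
      (p.form.nonneg x)
    rw [← hsp]
    exact h

end SimonLebesgue

/-! ### Adjoints, second adjoints and the factorization of `D` -/

section AdjointLemmas

theorem mem_adjoint_opComp_graph {H K F : Type*}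
    [NormedAddCommGroup H] [InnerProductSpace ℂ H]
    [NormedAddCommGroup K] [InnerProductSpace ℂ K] [CompleteSpace K]
    [NormedAddCommGroup F] [InnerProductSpace ℂ F] {e : K →ₗ.[ℂ] F} (C : H ≃ₗᵢ[ℂ] F) (x : H) (y : K) :
    (x, y) ∈ (opComp e.adjoint
      (((C.toContinuousLinearEquiv : H →L[ℂ] F) : H →ₗ[ℂ] F).toPMap ⊤)).graph ↔
      (C x, y) ∈ e.adjoint.graph := by
  rw [mem_opComp_graph]
  simp only [mem_toPMap_top_graph]
  constructor
  · rintro ⟨z, rfl, h⟩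
    exact h
  · exact fun h => ⟨_, rfl, h⟩

theorem isClosed_adjoint_opComp {H K F : Type*}
    [NormedAddCommGroup H] [InnerProductSpace ℂ H]
    [NormedAddCommGroup K] [InnerProductSpace ℂ K] [CompleteSpace K]
    [NormedAddCommGroup F] [InnerProductSpace ℂ F] {e : K →ₗ.[ℂ] F} (he : Dense (e.domain : Set K))
    (C : H ≃ₗᵢ[ℂ] F) :
    (opComp e.adjoint
      (((C.toContinuousLinearEquiv : H →L[ℂ] F) : H →ₗ[ℂ] F).toPMap ⊤)).IsClosed := by
  have h : Continuous fun p : H × K => (C p.1, p.2) := by fun_prop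
  refine (congrArg IsClosed (Set.ext ?_)).mpr ((LinearPMap.adjoint_isClosed he).preimage h)
  rintro ⟨x, y⟩
  exact mem_adjoint_opComp_graph C x y

variable {H : Type*} [NormedAddCommGroup H] [InnerProductSpace ℂ H] [CompleteSpace H]
variable {K : Type*} [NormedAddCommGroup K] [InnerProductSpace ℂ K] [CompleteSpace K]
variable {F : Type*} [NormedAddCommGroup F] [InnerProductSpace ℂ F] [CompleteSpace F]

/-- A vector which is orthogonal to the orthogonal complement of `N` lies in the closure of `N`. -/
theorem mem_closure_of_orthogonal {N : Submodule ℂ (H × K)} {p : H × K}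
    (h : ∀ r : H × K, (∀ q ∈ N, ⟪q.1, r.1⟫_ℂ + ⟪q.2, r.2⟫_ℂ = 0) →
      ⟪p.1, r.1⟫_ℂ + ⟪p.2, r.2⟫_ℂ = 0) : p ∈ N.topologicalClosure := by
  obtain ⟨c, hc, hr⟩ := exists_sub_orthogonal N p
  -- The remainder `p - c` is orthogonal to `p` by hypothesis and to `c` by construction, hence to
  -- itself.
  have h₁ := h (p - c) fun q hq => hr q (N.le_topologicalClosure hq)
  have h₂ := hr c hc
  have h₃ : ⟪(p - c).1, (p - c).1⟫_ℂ + ⟪(p - c).2, (p - c).2⟫_ℂ = 0 := by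
    nth_rw 1 [Prod.fst_sub, Prod.snd_sub]
    rw [inner_sub_left, inner_sub_left]
    linear_combination h₁ - h₂
  have h₄ := congrArg (RCLike.re : ℂ → ℝ) h₃
  rw [map_add, inner_self_eq_norm_sq, inner_self_eq_norm_sq, map_zero] at h₄
  have h₅ : ‖(p - c).1‖ = 0 := by nlinarith [sq_nonneg ‖(p - c).1‖, sq_nonneg ‖(p - c).2‖]
  have h₆ : ‖(p - c).2‖ = 0 := by nlinarith [sq_nonneg ‖(p - c).1‖, sq_nonneg ‖(p - c).2‖]
  have : p = c := sub_eq_zero.1 (Prod.ext (norm_eq_zero.1 h₅) (norm_eq_zero.1 h₆))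
  rwa [this]

/-- A closed operator coincides with its second adjoint. -/
theorem mem_graph_iff_adjoint {e : K →ₗ.[ℂ] F} (he : Dense (e.domain : Set K)) (hc : e.IsClosed)
    (y : K) (w : F) :
    (y, w) ∈ e.graph ↔ ∀ p ∈ e.adjoint.graph, ⟪w, p.1⟫_ℂ = ⟪y, p.2⟫_ℂ := by
  constructor
  · rintro h ⟨a, b⟩ hab
    have := (mem_adjoint_graph_iff he a b).1 hab _ h
    rw [← inner_conj_symm, ← this, inner_conj_symm]
  · intro h
    suffices (y, w) ∈ e.graph.topologicalClosure from hc.closure_subset this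
    refine mem_closure_of_orthogonal ?_
    rintro ⟨r₁, r₂⟩ hr
    -- The complement of the graph of `e` is the graph of `e*` with components swapped and one sign
    -- changed.
    have hr' : (r₂, -r₁) ∈ e.adjoint.graph := by
      rw [mem_adjoint_graph_iff he]
      intro q hq
      have := congrArg conj (hr q hq)
      rw [map_add, inner_conj_symm, inner_conj_symm, map_zero] at this
      rw [inner_neg_left]
      linear_combination -this
    have := h _ hr'
    simp only [inner_neg_right] at this ⊢
    linear_combination this

/-- This is `C* e e* C = T* T` for `T = e* C`: as `C` is unitary and `e` is closed, `T* = C* e** =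
C* e`, with no loss of domain. -/
theorem mem_opComp_adjoint_graph {e : K →ₗ.[ℂ] F} (he : Dense (e.domain : Set K))
    (hc : e.IsClosed) (C : H ≃ₗᵢ[ℂ] F)
    (hT : Dense ((opComp e.adjoint
      (((C.toContinuousLinearEquiv : H →L[ℂ] F) : H →ₗ[ℂ] F).toPMap ⊤)).domain : Set H))
    (x w : H) :
    (x, w) ∈ (opComp
      (((ContinuousLinearMap.adjoint (C.toContinuousLinearEquiv : H →L[ℂ] F)) :
        F →ₗ[ℂ] H).toPMap ⊤)
      (opComp e (opComp e.adjoint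
        (((C.toContinuousLinearEquiv : H →L[ℂ] F) : H →ₗ[ℂ] F).toPMap ⊤)))).graph ↔
    ∃ y, (x, y) ∈ (opComp e.adjoint
        (((C.toContinuousLinearEquiv : H →L[ℂ] F) : H →ₗ[ℂ] F).toPMap ⊤)).graph ∧
      (y, w) ∈ (opComp e.adjoint
        (((C.toContinuousLinearEquiv : H →L[ℂ] F) : H →ₗ[ℂ] F).toPMap ⊤)).adjoint.graph := by
  have hadj : ∀ g w, ContinuousLinearMap.adjoint (C.toContinuousLinearEquiv : H →L[ℂ] F) g = w ↔
      g = C w := by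
    intro g w
    have : ContinuousLinearMap.adjoint (C.toContinuousLinearEquiv : H →L[ℂ] F) g = C.symm g :=
      ext_inner_left ℂ fun v => by
        rw [ContinuousLinearMap.adjoint_inner_right, ← C.inner_map_map v, C.apply_symm_apply]
        rfl
    rw [this, LinearIsometryEquiv.symm_apply_eq]
  rw [mem_opComp_graph]
  have hTadj : ∀ y, (y, w) ∈ (opComp e.adjoint
        (((C.toContinuousLinearEquiv : H →L[ℂ] F) : H →ₗ[ℂ] F).toPMap ⊤)).adjoint.graph ↔
      (y, C w) ∈ e.graph := by
    intro y
    rw [mem_adjoint_graph_iff hT, mem_graph_iff_adjoint he hc]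
    constructor
    · rintro h ⟨a, b⟩ hab
      have := h (C.symm a, b) ((mem_adjoint_opComp_graph C _ _).2 (by
        rwa [C.apply_symm_apply]))
      rw [← C.inner_map_map w, C.apply_symm_apply] at this
      exact this
    · rintro h ⟨a, b⟩ hab
      have := h _ ((mem_adjoint_opComp_graph C _ _).1 hab)
      rwa [C.inner_map_map] at this
  constructor
  · rintro ⟨g, hg, hw⟩
    rw [mem_toPMap_top_graph] at hw
    obtain rfl := (hadj _ _).1 hw
    obtain ⟨y, h₁, h₂⟩ := (mem_opComp_graph _ _ _ _).1 hg
    exact ⟨y, h₁, (hTadj y).2 h₂⟩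
  · rintro ⟨y, h₁, h₂⟩
    exact ⟨C w, (mem_opComp_graph _ _ _ _).2 ⟨y, h₁, (hTadj y).1 h₂⟩,
      (mem_toPMap_top_graph _ _ _).2 ((hadj _ _).2 rfl)⟩

end AdjointLemmas

/-! ### Cauchy transforms, the embedding `e` and the operator `e* 𝒞_λ` -/

section CauchySpaces

/-- A vector orthogonal to the images of all Szegő kernels is orthogonal to the image of the disk
algebra. -/
theorem inner_eq_zero_of_inner_szego {H : Type*} [NormedAddCommGroup H] [InnerProductSpace ℂ H]
    [CompleteSpace H] (J : diskAlgebra →L[ℂ] H) (h : H)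
    (hz : ∀ z : 𝔻, ⟪J (szego z), h⟫_ℂ = 0) (a : diskAlgebra) : ⟪J a, h⟫_ℂ = 0 := by
  -- The range of `J` need not be dense, so `h` is replaced by its projection onto the closure of
  -- that range.
  let M : Submodule ℂ H := (LinearMap.range J.toLinearMap).topologicalClosure
  have : CompleteSpace M := (Submodule.isClosed_topologicalClosure _).completeSpace_coe
  have hJM : ∀ a, J a ∈ M := fun a => Submodule.le_topologicalClosure _ ⟨a, rfl⟩
  have hdense : DenseRange (J.codRestrict M hJM) := by
    intro x
    rw [IsInducing.subtypeVal.closure_eq_preimage_closure_image, ← Set.range_comp]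
    exact x.2
  have key : ∀ a, ⟪J.codRestrict M hJM a, M.orthogonalProjectionOnto h⟫_ℂ = ⟪J a, h⟫_ℂ := fun a =>
    Submodule.inner_orthogonalProjectionOnto_eq_of_mem_left (J.codRestrict M hJM a) h
  have h₀ := eq_zero_of_inner_szego (J.codRestrict M hJM) hdense (M.orthogonalProjectionOnto h)
    fun z => (key _).trans (hz z)
  rw [← key, h₀, inner_zero_right]

variable (μ lam : Measure circ) [IsFiniteMeasure μ] [IsFiniteMeasure lam]

/-- The map of the disk algebra into `ℋ⁺(μ)`, `a ↦ 𝒞_μ a`. -/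
noncomputable def toHPlus : diskAlgebra →L[ℂ] HPlus μ :=
  ((cauchy μ).toContinuousLinearEquiv : hardy μ →L[ℂ] HPlus μ).comp (toHardy μ)

theorem toHPlus_apply (a : diskAlgebra) : toHPlus μ a = cauchy μ (toHardy μ a) := rfl

theorem HPlus_apply (f : HPlus μ) (z : 𝔻) : f z = ⟪toHPlus μ (szego z), f⟫_ℂ := rfl

theorem denseRange_toHPlus : DenseRange (toHPlus μ) :=
  (cauchy μ).surjective.denseRange.comp (denseRange_toHardy μ) (cauchy μ).continuous

theorem ofMap_toHPlus : PSForm.ofMap (toHPlus μ).toLinearMap = measureForm μ := by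
  refine PSForm.toFun_injective (LinearMap.ext₂ fun g h => ?_)
  change ⟪toL2 μ g, toL2 μ h⟫_ℂ = _
  change _ = ∫ ζ, conj (boundary g ζ) * boundary h ζ ∂μ
  rw [L2.inner_def]
  refine integral_congr_ae ?_
  filter_upwards [ContinuousMap.coeFn_toLp (p := 2) (𝕜 := ℂ) μ (boundary g),
    ContinuousMap.coeFn_toLp (p := 2) (𝕜 := ℂ) μ (boundary h)] with ζ hg hh
  have hg' : (toL2 μ g : Lp ℂ 2 μ) ζ = boundary g ζ := hg
  have hh' : (toL2 μ h : Lp ℂ 2 μ) ζ = boundary h ζ := hh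
  rw [hg', hh', RCLike.inner_apply, mul_comm]

variable {μ lam}

/-- Equality of functions is equality of pairings with Szegő kernels. It extends to the whole disk
algebra because `(f, -g)` is then orthogonal to the kernels under the joint map `a ↦ (𝒞_μ a, 𝒞_λ
a)`. -/
theorem coe_eq_iff_inner (f : HPlus μ) (g : HPlus lam) :
    (g : 𝔻 → ℂ) = f ↔ ∀ a, ⟪toHPlus μ a, f⟫_ℂ = ⟪toHPlus lam a, g⟫_ℂ := by
  constructor
  · intro h a
    let e := WithLp.prodContinuousLinearEquiv 2 ℂ (HPlus μ) (HPlus lam)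
    let J : diskAlgebra →L[ℂ] WithLp 2 (HPlus μ × HPlus lam) :=
      (e.symm : HPlus μ × HPlus lam →L[ℂ] WithLp 2 (HPlus μ × HPlus lam)).comp
        ((toHPlus μ).prod (toHPlus lam))
    have hJ : ∀ a, ⟪J a, WithLp.toLp 2 (f, -g)⟫_ℂ = ⟪toHPlus μ a, f⟫_ℂ - ⟪toHPlus lam a, g⟫_ℂ := by
      intro a
      rw [WithLp.prod_inner_apply, sub_eq_add_neg, ← inner_neg_right]
      rfl
    have := inner_eq_zero_of_inner_szego J (WithLp.toLp 2 (f, -g)) (fun z => by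
      rw [hJ, ← HPlus_apply, ← HPlus_apply, h, sub_self]) a
    rwa [hJ, sub_eq_zero] at this
  · intro h
    funext z
    rw [HPlus_apply, HPlus_apply, h]

theorem mem_embedding_graph_iff (f : interClosure μ lam) (g : HPlus lam) :
    (f, g) ∈ (embedding μ lam).graph ↔
      ∀ a, ⟪toHPlus μ a, (f : HPlus μ)⟫_ℂ = ⟪toHPlus lam a, g⟫_ℂ := by
  rw [← coe_eq_iff_inner]
  constructor
  · intro h
    obtain ⟨hf, rfl⟩ := exists_apply_eq_of_mem_graph h
    exact funext fun z => embedding_apply μ lam ⟨f, hf⟩ z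
  · intro h
    have hf : f ∈ (embedding μ lam).domain := ⟨g, h⟩
    have : embedding μ lam ⟨f, hf⟩ = g := DFunLike.coe_injective
      ((funext fun z => embedding_apply μ lam ⟨f, hf⟩ z).trans h.symm)
    rw [← this]
    exact (embedding μ lam).mem_graph ⟨f, hf⟩

theorem exists_mem_embedding_graph {f : HPlus μ} {g : HPlus lam}
    (h : ∀ a, ⟪toHPlus μ a, f⟫_ℂ = ⟪toHPlus lam a, g⟫_ℂ) :
    ∃ hf : f ∈ interClosure μ lam, ((⟨f, hf⟩ : interClosure μ lam), g) ∈ (embedding μ lam).graph :=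
  ⟨Submodule.le_topologicalClosure _ ⟨g, (coe_eq_iff_inner f g).2 h⟩,
    (mem_embedding_graph_iff _ g).2 h⟩

variable (μ lam)

/-- Each condition `⟪a, f⟫_μ = ⟪a, g⟫_λ` is closed in `(f, g)`, and the graph is their intersection.
-/
theorem embedding_isClosed : (embedding μ lam).IsClosed := by
  have : ((embedding μ lam).graph : Set (interClosure μ lam × HPlus lam)) =
      ⋂ a, {p | ⟪toHPlus μ a, (p.1 : HPlus μ)⟫_ℂ = ⟪toHPlus lam a, p.2⟫_ℂ} := by
    ext ⟨f, g⟩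
    rw [Set.mem_iInter]
    exact mem_embedding_graph_iff f g
  change IsClosed ((embedding μ lam).graph : Set (interClosure μ lam × HPlus lam))
  rw [this]
  exact isClosed_iInter fun a => isClosed_eq (by fun_prop) (by fun_prop)

/-- The operator `e* 𝒞_λ` from `H²(λ)` into the closure of `int(μ, λ)`. -/
noncomputable def embeddingAdjoint : hardy lam →ₗ.[ℂ] interClosure μ lam :=
  opComp (embedding μ lam).adjoint
    ((((cauchy lam).toContinuousLinearEquiv : hardy lam →L[ℂ] HPlus lam) :
      hardy lam →ₗ[ℂ] HPlus lam).toPMap ⊤)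

theorem mem_embeddingAdjoint_graph_iff (x : hardy lam) (y : interClosure μ lam) :
    (x, y) ∈ (embeddingAdjoint μ lam).graph ↔
      ∀ p ∈ (embedding μ lam).graph, ⟪y, p.1⟫_ℂ = ⟪cauchy lam x, p.2⟫_ℂ :=
  (mem_adjoint_opComp_graph (cauchy lam) x y).trans
    (mem_adjoint_graph_iff (dense_embedding_domain μ lam) _ _)

/-- For `f` in the domain of `e`, `⟪𝒞_λ a, e f⟫ = ⟪𝒞_μ a, f⟫ = ⟪P 𝒞_μ a, f⟫`, so `e* 𝒞_λ a = P 𝒞_μ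
a`. This also makes `e* 𝒞_λ` densely defined. -/
theorem toHardy_mem_embeddingAdjoint_graph (a : diskAlgebra) :
    (toHardy lam a, (interClosure μ lam).orthogonalProjectionOnto (toHPlus μ a)) ∈
      (embeddingAdjoint μ lam).graph := by
  rw [mem_embeddingAdjoint_graph_iff]
  rintro ⟨f, g⟩ hfg
  rw [← toHPlus_apply, ← (mem_embedding_graph_iff f g).1 hfg a]
  exact Submodule.inner_orthogonalProjectionOnto_eq_of_mem_right f (toHPlus μ a)

theorem dense_embeddingAdjoint_domain :
    Dense ((embeddingAdjoint μ lam).domain : Set (hardy lam)) := by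
  refine (denseRange_toHardy lam).mono ?_
  rintro _ ⟨a, rfl⟩
  exact (exists_apply_eq_of_mem_graph (toHardy_mem_embeddingAdjoint_graph μ lam a)).1

theorem embeddingAdjoint_isClosed : (embeddingAdjoint μ lam).IsClosed :=
  isClosed_adjoint_opComp (dense_embedding_domain μ lam) (cauchy lam)

/-- By duality it suffices that the graph of `e* 𝒞_λ` annihilates whatever is orthogonal to all
pairs of images of `a`, and those orthogonal vectors come from the graph of `e`. -/
theorem embeddingAdjoint_graph_subset (p : hardy lam × interClosure μ lam)
    (hp : p ∈ (embeddingAdjoint μ lam).graph) :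
    (p.1, (p.2 : HPlus μ)) ∈
      closure (Set.range fun a => ((toHardy lam).toLinearMap a, (toHPlus μ).toLinearMap a)) := by
  suffices (p.1, (p.2 : HPlus μ)) ∈ (LinearMap.range
    ((toHardy lam).toLinearMap.prod (toHPlus μ).toLinearMap)).topologicalClosure from this
  refine mem_closure_of_orthogonal ?_
  rintro ⟨r₁, r₂⟩ hr
  -- Orthogonality reads `⟪a, r₂⟫_μ = -⟪a, r₁⟫_λ`, that is, `r₂ ∈ int(μ, λ)` and `e r₂ = -𝒞_λ r₁`.
  obtain ⟨hf, hg⟩ := exists_mem_embedding_graph (f := r₂) (g := -cauchy lam r₁) fun a => by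
    have : ⟪toHardy lam a, r₁⟫_ℂ + ⟪toHPlus μ a, r₂⟫_ℂ = 0 :=
      hr (toHardy lam a, toHPlus μ a) ⟨a, rfl⟩
    rw [inner_neg_right, toHPlus_apply lam, (cauchy lam).inner_map_map]
    linear_combination this
  have := (mem_embeddingAdjoint_graph_iff μ lam p.1 p.2).1 hp _ hg
  rw [inner_neg_right, (cauchy lam).inner_map_map] at this
  change ⟪(p.2 : HPlus μ), r₂⟫_ℂ = _ at this
  simp only
  linear_combination this

theorem isFormOf_opD :
    (DenseForm.ofOp (embeddingAdjoint μ lam) (dense_embeddingAdjoint_domain μ lam)).IsFormOf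
      (opD μ lam) :=
  DenseForm.ofOp_isFormOf _ (embeddingAdjoint_isClosed μ lam) fun x w =>
    mem_opComp_adjoint_graph (dense_embedding_domain μ lam) (embedding_isClosed μ lam) (cauchy lam)
      (dense_embeddingAdjoint_domain μ lam) x w

theorem isSimonLebesgue_measureForm :
    IsSimonLebesgue (toHardy lam).toLinearMap (measureForm μ)
      (PSForm.ofMap ((interClosure μ lam).orthogonalProjectionOnto.toLinearMap ∘ₗ
        (toHPlus μ).toLinearMap))
      (PSForm.ofMap ((interClosure μ lam)ᗮ.orthogonalProjectionOnto.toLinearMap ∘ₗ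
        (toHPlus μ).toLinearMap)) ∧
    (DenseForm.ofOp (embeddingAdjoint μ lam) (dense_embeddingAdjoint_domain μ lam)).IsClosureOf
      (toHardy lam).toLinearMap
      (PSForm.ofMap ((interClosure μ lam).orthogonalProjectionOnto.toLinearMap ∘ₗ
        (toHPlus μ).toLinearMap)) := by
  rw [← ofMap_toHPlus]
  exact isSimonLebesgue_ofMap _ (denseRange_toHardy lam) (dense_embeddingAdjoint_domain μ lam)
    (embeddingAdjoint_isClosed μ lam) (toHardy_mem_embeddingAdjoint_graph μ lam)
    (embeddingAdjoint_graph_subset μ lam)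

theorem exists_unitary_formHPlus
    (hq : ∀ a, PSForm.ofMap ((interClosure μ lam).orthogonalProjectionOnto.toLinearMap ∘ₗ
      (toHPlus μ).toLinearMap) a a ≤ measureForm μ a a) :
    ∃ U : FormHPlus (PSForm.ofMap ((interClosure μ lam).orthogonalProjectionOnto.toLinearMap ∘ₗ
        (toHPlus μ).toLinearMap)) μ hq ≃ₗᵢ[ℂ] interClosure μ lam,
      ∀ f (z : 𝔻), (U f : HPlus μ) z = f z := by
  set j := (interClosure μ lam).orthogonalProjectionOnto.toLinearMap ∘ₗ
    (toHPlus μ).toLinearMap with hj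
  have hjd : DenseRange j := by
    have hP : Function.Surjective (interClosure μ lam).orthogonalProjectionOnto := fun x =>
      ⟨x, Submodule.orthogonalProjectionOnto_mem_subspace_eq_self x⟩
    exact hP.denseRange.comp (denseRange_toHPlus μ)
      (interClosure μ lam).orthogonalProjectionOnto.continuous
  have hd : DenseRange (toH2 (PSForm.ofMap j)) :=
    UniformSpace.Completion.denseRange_coe (α := PreH2 (PSForm.ofMap j))
  -- The class of `a` goes to `P 𝒞_μ a`: isometric by the choice of the form, with dense range on
  -- both sides.
  let U₀ : H2 (PSForm.ofMap j) ≃ₗᵢ[ℂ] interClosure μ lam :=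
    (LinearEquiv.refl ℂ diskAlgebra).extendOfIsometry (toH2 (PSForm.ofMap j)) j hd hjd fun a => by
      rw [← sq_eq_sq₀ (norm_nonneg _) (norm_nonneg _), ← inner_self_eq_norm_sq (𝕜 := ℂ) (toH2 _ a),
        inner_toH2]
      exact (PSForm.re_ofMap_self j a).symm
  have hU : ∀ a, U₀ (toH2 (PSForm.ofMap j) a) = j a := fun a =>
    LinearEquiv.extendOfIsometry_eq _ _ _ _ _ _ a
  refine ⟨(formCauchy (PSForm.ofMap j) μ hq).symm.trans U₀, fun f z => ?_⟩
  obtain ⟨h, rfl⟩ := (formCauchy (PSForm.ofMap j) μ hq).surjective f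
  -- The value at `z` is `⟪k_z, h⟫ = ⟪P k_z, U₀ h⟫`, and `P` may be dropped because `U₀ h` lies in
  -- its range.
  rw [formCauchy_apply, ← U₀.inner_map_map, hU, HPlus_apply]
  change ⟪toHPlus μ (szego z), ((U₀ h : interClosure μ lam) : HPlus μ)⟫_ℂ = _
  exact (Submodule.inner_orthogonalProjectionOnto_eq_of_mem_right (U₀ h) _).symm

end CauchySpaces

end CauchyForms

theorem theorem5p10 (μ lam : Measure circ) [IsFiniteMeasure μ] [IsFiniteMeasure lam] :
    (∃! p : PSForm diskAlgebra × PSForm diskAlgebra,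
      IsSimonLebesgue (toHardy lam).toLinearMap (measureForm μ) p.1 p.2) ∧
    ∀ (qac qs : PSForm diskAlgebra)
      (h : IsSimonLebesgue (toHardy lam).toLinearMap (measureForm μ) qac qs),
      (∃ U : FormHPlus qac μ h.ac_le ≃ₗᵢ[ℂ] interClosure μ lam,
        ∀ (f : FormHPlus qac μ h.ac_le) (z : 𝔻), (U f : HPlus μ) z = f z) ∧
      (embedding μ lam).IsClosed ∧
      ∃ t : DenseForm (hardy lam),
        t.IsClosureOf (toHardy lam).toLinearMap qac ∧ t.IsFormOf (opD μ lam) := by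
  obtain ⟨hSL, hcl⟩ := isSimonLebesgue_measureForm μ lam
  refine ⟨⟨(_, _), hSL, fun p hp => Prod.ext (hp.unique hSL).1 (hp.unique hSL).2⟩,
    fun qac qs h => ?_⟩
  obtain ⟨rfl, rfl⟩ := h.unique hSL
  exact ⟨exists_unitary_formHPlus μ lam h.ac_le, embedding_isClosed μ lam, _, hcl,
    isFormOf_opD μ lam⟩
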